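/- Let $n\ge 1$, let $q,t^{1/2}\in\mathbb C^\times$, $t=(t^{1/2})^2$, and let $S_n$ act on $\mathbb C[X]=\mathbb C[x_1^{\pm1},\dots,x_n^{\pm1}]$ by permuting the variables, with simple transpositions $s_1,\dots,s_{n-1}$. Define operators on $\mathbb C[X]$ by $$T_i=t^{-\frac12}\Bigl(t-\frac{tx_i-x_{i+1}}{x_i-x_{i+1}}(1-s_i)\Bigr),\qquad (T_{q^{-1},x_n}h)(x_1,\dots,x_n)=h(x_1,\dots,x_{n-1},q^{-1}x_n),\qquad g=s_1\cdots s_{n-1}T_{q^{-1},x_n},$$ $$Y_1=gT_{n-1}\cdots T_1,\qquad Y_{i+1}=T_i^{-1}Y_iT_i^{-1},\qquad \tau_i^\vee=T_i+\frac{t^{-1/2}(1-t)}{1-Y_i^{-1}Y_{i+1}}\qquad(1\le i\le n-1),$$ and let $H$ be the algebra generated by $T_1,\dots,T_{n-1},Y_1^{\pm1},\dots,Y_n^{\pm1}$. For $\mu\in\mathbb Z^n$ let $v_\mu\in S_n$ be the minimal length permutation such that $v_\mu\mu$ is weakly increasing (where $(w\mu)_j=\mu_{w^{-1}(j)}$),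 and let $E_\mu\in\mathbb C[X]$ be the element such that $$Y_iE_\mu=q^{-\mu_i}t^{-(v_\mu(i)-1)+\frac12(n-1)}E_\mu\ \ (1\le i\le n)\qquad\text{and the coefficient of }x_1^{\mu_1}\cdots x_n^{\mu_n}\text{ in }E_\mu\text{ is }1.$$ Assume that the parameters are generic in the following sense: $t\ne1$, and the $n$-tuples $\bigl(q^{-\mu_i}t^{-(v_\mu(i)-1)+\frac12(n-1)}\bigr)_{i=1}^n$, $\mu\in\mathbb Z^n$, are pairwise distinct. (This holds for instance if $q^at^b\neq1$ for all $(a,b)\in\mathbb Z^2\setminus\{(0,0)\}$.) Then the operators $T_i$, $Y_i$ and $1-Y_i^{-1}Y_{i+1}$ are invertible, for each $\mu$ there is exactly one $E_\mu$ as above, and the $T_i$, $Y_i$ satisfy the relations of the affine Hecke algebra of type $GL_n$: $T_i^2=(t^{1/2}-t^{-1/2})T_i+1$, the braid relations $T_iT_{i+1}T_i=T_{i+1}T_iT_{i+1}$ and $T_iT_j=T_jT_i$ for $|i-j|>1$, $Y_iY_j=Y_jY_i$, $T_iY_{i+1}T_i=Y_i$, and $T_iY_j=Y_jT_i$ for $j\ne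 i,i+1$. The $E_\mu$, $\mu\in\mathbb Z^n$, are linearly independent, and as $H$-modules $$\mathbb C[X]=\bigoplus_\lambda\mathbb C[X]^\lambda,\qquad \mathbb C[X]^\lambda=\operatorname{span}\{E_\mu\mid\mu\in S_n\lambda\},$$ where the sum is over all $\lambda=(\lambda_1\ge\dots\ge\lambda_n)\in\mathbb Z^n$; that is, each $\mathbb C[X]^\lambda$ is an $H$-submodule and $\mathbb C[X]$ is their direct sum. The action of $H$ is given as follows. Let $\mu\in\mathbb Z^n$ and $i\in\{1,\dots,n-1\}$, and put $$a_\mu=q^{\mu_i-\mu_{i+1}}t^{v_\mu(i)-v_\mu(i+1)},\qquad a_{s_i\mu}=q^{\mu_{i+1}-\mu_i}t^{v_\mu(i+1)-v_\mu(i)},\qquad D_\mu=\frac{(1-ta_\mu)(1-ta_{s_i\mu})}{(1-a_\mu)(1-a_{s_i\mu})}.$$ If $\mu_i>\mu_{i+1}$, then $a_\mu\ne1$, $a_{s_i\mu}\neq1$ and $$Y_i^{-1}Y_{i+1}E_\mu=a_\mu E_\mu,\qquad t^{\frac12}\tau_i^\vee E_\mu=E_{s_i\mu},\qquad t^{\frac12}T_iE_\mu=-\frac{1-t}{1-a_\mu}E_\mu+E_{s_i\mu},$$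 $$Y_i^{-1}Y_{i+1}E_{s_i\mu}=a_{s_i\mu}E_{s_i\mu},\qquad t^{\frac12}\tau_i^\vee E_{s_i\mu}=D_\mu E_\mu,\qquad t^{\frac12}T_iE_{s_i\mu}=D_\mu E_\mu-\frac{1-t}{1-a_{s_i\mu}}E_{s_i\mu}.$$ If $\mu_i=\mu_{i+1}$, then $v_\mu(i+1)=v_\mu(i)+1$, $a_\mu=t^{-1}$ and $$Y_i^{-1}Y_{i+1}E_\mu=t^{-1}E_\mu,\qquad (t^{\frac12}\tau_i^\vee)E_\mu=0,\qquad (t^{\frac12}T_i)E_\mu=tE_\mu.$$ -/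

import Mathlib

namespace Macdonald

/-- The Laurent polynomial ring `ℂ[x₁^{±1}, …, x_N^{±1}]`; the monomial `x^μ` is `single μ 1`. -/
abbrev Laurent (N : ℕ) : Type := AddMonoidAlgebra ℂ (Fin N → ℤ)

/-- The monomial `x^μ`. -/
noncomputable def mon {N : ℕ} (μ : Fin N → ℤ) : Laurent N := AddMonoidAlgebra.single μ 1

/-- The variable `x_i`. -/
noncomputable def X {N : ℕ} (i : Fin N) : Laurent N := mon (Pi.single i 1)

/-- The linear operator with prescribed values on the monomials. -/
noncomputable def monLin {N : ℕ} (φ : (Fin N → ℤ) → Laurent N) : Module.End ℂ (Laurent N) :=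
  Finsupp.linearCombination ℂ φ ∘ₗ (AddMonoidAlgebra.coeffLinearEquiv ℂ).toLinearMap

theorem monLin_mon {N : ℕ} (φ : (Fin N → ℤ) → Laurent N) (μ : Fin N → ℤ) :
    monLin φ (mon μ) = φ μ := by
  change Finsupp.linearCombination ℂ φ (Finsupp.single μ 1) = φ μ
  simp

/- Throughout, the number of variables is `n + 1`, the positions `1, …, n + 1` are the elements of
`Fin (n + 1)`, and `i : Fin n` labels the pair of neighbouring positions `i.castSucc`, `i.succ`. -/

/-- The simple transposition `s_i` acting on `ℤ^{n+1}`. -/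
def sAct {n : ℕ} (i : Fin n) (μ : Fin (n + 1) → ℤ) : Fin (n + 1) → ℤ :=
  μ ∘ Equiv.swap i.castSucc i.succ

/-- The operator `s_i` exchanging the variables `x_i` and `x_{i+1}`. -/
noncomputable def sOp {n : ℕ} (i : Fin n) : Module.End ℂ (Laurent (n + 1)) :=
  monLin fun μ => mon (sAct i μ)

/-- The divided difference `f ↦ (f - s_i f) / (x_i - x_{i+1})`, written out on monomials as a
geometric sum; see `X_sub_X_mul_divDiff`. -/
noncomputable def divDiff {n : ℕ} (i : Fin n) : Module.End ℂ (Laurent (n + 1)) :=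
  monLin fun μ =>
    (∑ j ∈ Finset.range (μ i.castSucc - μ i.succ).toNat,
      mon (μ - ((j : ℤ) + 1) • Pi.single i.castSucc 1 + (j : ℤ) • Pi.single i.succ 1)) -
    ∑ j ∈ Finset.range (μ i.succ - μ i.castSucc).toNat,
      mon (sAct i μ - ((j : ℤ) + 1) • Pi.single i.castSucc 1 + (j : ℤ) • Pi.single i.succ 1)

theorem mon_mul_mon {N : ℕ} (μ ν : Fin N → ℤ) : mon μ * mon ν = mon (μ + ν) := by
  simp [mon]

theorem X_sub_X_mul_sum {n : ℕ} (i : Fin n) (μ : Fin (n + 1) → ℤ) (k : ℕ) :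
    (X i.castSucc - X i.succ) * ∑ j ∈ Finset.range k,
      mon (μ - ((j : ℤ) + 1) • Pi.single i.castSucc 1 + (j : ℤ) • Pi.single i.succ 1) =
    mon μ - mon (μ - (k : ℤ) • Pi.single i.castSucc 1 + (k : ℤ) • Pi.single i.succ 1) := by
  induction k with
  | zero => simp
  | succ k ih =>
    rw [Finset.sum_range_succ, mul_add, ih, sub_mul, X, X, mon_mul_mon, mon_mul_mon]
    have h1 : (Pi.single i.castSucc 1 : Fin (n + 1) → ℤ) +
        (μ - ((k : ℤ) + 1) • Pi.single i.castSucc 1 + (k : ℤ) • Pi.single i.succ 1) =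
        μ - (k : ℤ) • Pi.single i.castSucc 1 + (k : ℤ) • Pi.single i.succ 1 := by
      rw [add_smul, one_smul]; abel
    have h2 : (Pi.single i.succ 1 : Fin (n + 1) → ℤ) +
        (μ - ((k : ℤ) + 1) • Pi.single i.castSucc 1 + (k : ℤ) • Pi.single i.succ 1) =
        μ - ((k + 1 : ℕ) : ℤ) • Pi.single i.castSucc 1 +
          ((k + 1 : ℕ) : ℤ) • Pi.single i.succ 1 := by
      push_cast; rw [add_smul, add_smul, one_smul, one_smul]; abel
    rw [h1, h2]; abel

theorem shift_eq_sAct {n : ℕ} (i : Fin n) (μ : Fin (n + 1) → ℤ) :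
    μ - (μ i.castSucc - μ i.succ) • Pi.single i.castSucc 1 +
      (μ i.castSucc - μ i.succ) • Pi.single i.succ 1 = sAct i μ := by
  have hne : i.castSucc ≠ i.succ := (Fin.castSucc_lt_succ (i := i)).ne
  funext j
  by_cases h1 : j = i.castSucc
  · subst h1; simp [sAct, hne]
  · by_cases h2 : j = i.succ
    · subst h2; simp [sAct, hne.symm]
    · simp [sAct, h1, h2, Equiv.swap_apply_of_ne_of_ne]

theorem sAct_sAct {n : ℕ} (i : Fin n) (μ : Fin (n + 1) → ℤ) : sAct i (sAct i μ) = μ := by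
  funext j; simp [sAct]

/-- `divDiff i f` is the quotient of `f - s_i f` by `x_i - x_{i+1}`. -/
theorem X_sub_X_mul_divDiff {n : ℕ} (i : Fin n) (f : Laurent (n + 1)) :
    (X i.castSucc - X i.succ) * divDiff i f = f - sOp i f := by
  have key : LinearMap.mulLeft ℂ (X i.castSucc - X i.succ) ∘ₗ divDiff i = 1 - sOp i := by
    apply AddMonoidAlgebra.lhom_ext'
    intro μ
    refine LinearMap.ext_ring ?_
    change (X i.castSucc - X i.succ) * divDiff i (mon μ) = mon μ - sOp i (mon μ)
    rw [divDiff, sOp, monLin_mon, monLin_mon, mul_sub, X_sub_X_mul_sum, X_sub_X_mul_sum]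
    rcases le_total (μ i.succ) (μ i.castSucc) with h | h
    · have h0 : (μ i.succ - μ i.castSucc).toNat = 0 := by omega
      rw [h0, Int.toNat_of_nonneg (by omega), shift_eq_sAct]
      simp
    · have h0 : (μ i.castSucc - μ i.succ).toNat = 0 := by omega
      have hs := shift_eq_sAct i (sAct i μ)
      have e1 : sAct i μ i.castSucc = μ i.succ := by simp [sAct]
      have e2 : sAct i μ i.succ = μ i.castSucc := by simp [sAct]
      rw [e1, e2, sAct_sAct] at hs
      rw [h0, Int.toNat_of_nonneg (by omega), hs]
      simp
  exact LinearMap.congr_fun key f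

/-! The parameter `th` stands for `t^{1/2}`, so that `t = th ^ 2`. -/

/-- `T_i = t^{-1/2} (t - (t x_i - x_{i+1}) / (x_i - x_{i+1}) (1 - s_i))`. -/
noncomputable def T {n : ℕ} (th : ℂ) (i : Fin n) : Module.End ℂ (Laurent (n + 1)) :=
  th⁻¹ • (th ^ 2 • (1 : Module.End ℂ (Laurent (n + 1))) -
    LinearMap.mulLeft ℂ (th ^ 2 • X i.castSucc - X i.succ) ∘ₗ divDiff i)

/-- `h(x₁, …, x_{n+1}) ↦ h(x₁, …, x_n, q⁻¹ x_{n+1})`. -/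
noncomputable def qShift {n : ℕ} (q : ℂ) : Module.End ℂ (Laurent (n + 1)) :=
  monLin fun μ => q ^ (-μ (Fin.last n)) • mon μ

/-- `g = s_1 s_2 ⋯ s_n T_{q⁻¹, x_{n+1}}`. -/
noncomputable def g {n : ℕ} (q : ℂ) : Module.End ℂ (Laurent (n + 1)) :=
  (List.ofFn fun i : Fin n => sOp i).prod * qShift q

/-- The Cherednik–Dunkl operators: `Y_1 = g T_n ⋯ T_1` and `Y_{i+1} = T_i⁻¹ Y_i T_i⁻¹`.
(`Ring.inverse` is the two-sided inverse of an invertible operator.) -/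
noncomputable def Y {n : ℕ} (q th : ℂ) : Fin (n + 1) → Module.End ℂ (Laurent (n + 1)) :=
  Fin.induction (g q * (List.ofFn fun i : Fin n => T th i).reverse.prod)
    fun i Yi => Ring.inverse (T th i) * Yi * Ring.inverse (T th i)

/-- The operator `Y_i⁻¹ Y_{i+1}`. -/
noncomputable def YY {n : ℕ} (q th : ℂ) (i : Fin n) : Module.End ℂ (Laurent (n + 1)) :=
  Ring.inverse (Y q th i.castSucc) * Y q th i.succ

/-- The intertwiner `τ_i^∨ = T_i + t^{-1/2} (1 - t) / (1 - Y_i⁻¹ Y_{i+1})`. -/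
noncomputable def tau {n : ℕ} (q th : ℂ) (i : Fin n) : Module.End ℂ (Laurent (n + 1)) :=
  T th i + (th⁻¹ * (1 - th ^ 2)) • Ring.inverse (1 - YY q th i)

/-- The algebra `H` generated by the `T_i` and the `Y_i^{±1}`. -/
noncomputable def H (n : ℕ) (q th : ℂ) : Subalgebra ℂ (Module.End ℂ (Laurent (n + 1))) :=
  Algebra.adjoin ℂ (Set.range (T (n := n) th) ∪ Set.range (Y (n := n) q th) ∪
    Set.range fun i : Fin (n + 1) => Ring.inverse (Y (n := n) q th i))

/-- The relations of the affine Hecke algebra of type `GL_{n+1}` with parameter `t = th ^ 2`. -/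
structure AffineHeckeRelations {n : ℕ} {A : Type*} [Ring A] [Algebra ℂ A] (th : ℂ)
    (T : Fin n → A) (Y : Fin (n + 1) → A) : Prop where
  quadratic : ∀ i, T i * T i = (th - th⁻¹) • T i + 1
  braid : ∀ i j : Fin n, (i : ℕ) + 1 = j → T i * T j * T i = T j * T i * T j
  far : ∀ i j : Fin n, (i : ℕ) + 1 < j → T i * T j = T j * T i
  isUnit_Y : ∀ j, IsUnit (Y j)
  Y_comm : ∀ j k, Y j * Y k = Y k * Y j
  T_Y_T : ∀ i, T i * Y i.succ * T i = Y i.castSucc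
  T_Y : ∀ (i : Fin n) (j : Fin (n + 1)), j ≠ i.castSucc → j ≠ i.succ → T i * Y j = Y j * T i

/-- The set of inversions of a permutation. -/
def inversions {N : ℕ} (w : Equiv.Perm (Fin N)) : Finset (Fin N × Fin N) :=
  {p | p.1 < p.2 ∧ w p.2 < w p.1}

/-- The length of a permutation. -/
def len {N : ℕ} (w : Equiv.Perm (Fin N)) : ℕ := (inversions w).card

/-- `v` has minimal length among the permutations `w` such that `w μ` is weakly increasing,
where `(w μ)_j = μ_{w⁻¹(j)}`. -/
def IsMinSort {N : ℕ} (μ : Fin N → ℤ) (v : Equiv.Perm (Fin N)) : Prop :=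
  Monotone (μ ∘ ⇑v⁻¹) ∧ ∀ w : Equiv.Perm (Fin N), Monotone (μ ∘ ⇑w⁻¹) → len v ≤ len w

theorem exists_isMinSort {N : ℕ} (μ : Fin N → ℤ) : ∃ v, IsMinSort μ v := by
  classical
  obtain ⟨v, hv, h⟩ := Finset.exists_min_image
    (Finset.univ.filter fun w : Equiv.Perm (Fin N) => Monotone (μ ∘ ⇑w⁻¹)) len
    ⟨(Tuple.sort μ)⁻¹, by
      rw [Finset.mem_filter, inv_inv]; exact ⟨Finset.mem_univ _, Tuple.monotone_sort μ⟩⟩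
  exact ⟨v, by simpa using hv, fun w hw => h w (by simpa using hw)⟩

/-- The minimal length permutation `v_μ` such that `v_μ μ` is weakly increasing. Positions are
counted from `0`, so the `v_μ(i)` of the usual numbering is `(vPerm μ i : ℕ) + 1`. -/
noncomputable def vPerm {N : ℕ} (μ : Fin N → ℤ) : Equiv.Perm (Fin N) :=
  Classical.choose (exists_isMinSort μ)

/-- There is only one such permutation. -/
theorem IsMinSort.eq_sort_inv {N : ℕ} {μ : Fin N → ℤ} {v : Equiv.Perm (Fin N)}
    (hv : IsMinSort μ v) : v = (Tuple.sort μ)⁻¹ := by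
  have lt_of : ∀ w : Equiv.Perm (Fin N), Monotone (μ ∘ ⇑w⁻¹) →
      ∀ a b, μ a < μ b → w a < w b := by
    intro w hw a b hab
    by_contra hcon
    have := hw (not_lt.mp hcon)
    simp at this
    omega
  set u := (Tuple.sort μ)⁻¹ with hu
  have hum : Monotone (μ ∘ ⇑u⁻¹) := by simpa [hu] using Tuple.monotone_sort μ
  have hstab := (Tuple.eq_sort_iff (f := μ) (σ := u⁻¹)).1 (by simp [hu])
  have hsub : inversions u ⊆ inversions v := by
    rintro ⟨a, b⟩ hp
    simp only [inversions, Finset.mem_filter, Finset.mem_univ, true_and] at hp ⊢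
    refine ⟨hp.1, lt_of v hv.1 _ _ ?_⟩
    by_contra hcon
    rcases (not_lt.mp hcon).lt_or_eq with h | h
    · exact absurd (lt_of u hum a b h) (not_lt.mpr hp.2.le)
    · have := hstab.2 (u b) (u a) hp.2 (by simpa using h.symm)
      simp at this
      exact absurd this (not_lt.mpr hp.1.le)
  have heq : inversions u = inversions v := Finset.eq_of_subset_of_card_le hsub (hv.2 u hum)
  have hfin : v⁻¹ = Tuple.sort μ := by
    refine Tuple.eq_sort_iff.2 ⟨hv.1, fun i j hij he => ?_⟩
    by_contra hcon
    have hne : v⁻¹ j ≠ v⁻¹ i := fun h => hij.ne (v⁻¹.injective h.symm)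
    have hlt : v⁻¹ j < v⁻¹ i := lt_of_le_of_ne (not_lt.mp hcon) hne
    have hmem : (v⁻¹ j, v⁻¹ i) ∈ inversions v := by
      simpa [inversions, hij] using hlt
    rw [← heq] at hmem
    simp only [inversions, Finset.mem_filter, Finset.mem_univ, true_and] at hmem
    have h3 := hstab.2 (u (v⁻¹ i)) (u (v⁻¹ j)) hmem.2 (by simpa using he)
    simp at h3
    exact absurd hlt (not_lt.mpr (by simpa using h3.le))
  rw [hu, ← hfin, inv_inv]

theorem vPerm_eq {N : ℕ} (μ : Fin N → ℤ) : vPerm μ = (Tuple.sort μ)⁻¹ :=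
  (Classical.choose_spec (exists_isMinSort μ)).eq_sort_inv

/-- The number `q^{-μ_i} t^{-(v_μ(i) - 1) + (N - 1) / 2}`, with `N = n + 1`. -/
noncomputable def eig {n : ℕ} (q th : ℂ) (μ : Fin (n + 1) → ℤ) (i : Fin (n + 1)) : ℂ :=
  q ^ (-μ i) * th ^ (-2 * ((vPerm μ i : ℕ) : ℤ) + n)

/-- The conditions that define the nonsymmetric Macdonald polynomial `E_μ`. -/
def IsNonsymMacdonald {n : ℕ} (q th : ℂ) (μ : Fin (n + 1) → ℤ) (f : Laurent (n + 1)) : Prop :=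
  (∀ i, Y q th i f = eig q th μ i • f) ∧ f.coeff μ = 1

/-- The nonsymmetric Macdonald polynomial `E_μ`. -/
noncomputable def E {n : ℕ} (q th : ℂ) (μ : Fin (n + 1) → ℤ) : Laurent (n + 1) :=
  Classical.epsilon (IsNonsymMacdonald q th μ)

/-- `ℂ[X]^λ`, the span of the `E_μ` for `μ` in the orbit of `l` under permutations. -/
noncomputable def CX {n : ℕ} (q th : ℂ) (l : Fin (n + 1) → ℤ) : Submodule ℂ (Laurent (n + 1)) :=
  Submodule.span ℂ (E q th '' {μ | ∃ σ : Equiv.Perm (Fin (n + 1)), μ = l ∘ σ})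

/-- `q^{μ_j - μ_k} t^{v_μ(j) - v_μ(k)}`. -/
noncomputable def ratio {n : ℕ} (q th : ℂ) (μ : Fin (n + 1) → ℤ) (j k : Fin (n + 1)) : ℂ :=
  q ^ (μ j - μ k) * (th ^ 2) ^ (((vPerm μ j : ℕ) : ℤ) - ((vPerm μ k : ℕ) : ℤ))

/-- `a_μ = q^{μ_i - μ_{i+1}} t^{v_μ(i) - v_μ(i+1)}`. -/
noncomputable def a {n : ℕ} (q th : ℂ) (i : Fin n) (μ : Fin (n + 1) → ℤ) : ℂ :=
  ratio q th μ i.castSucc i.succ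

/-- `a_{s_i μ} = q^{μ_{i+1} - μ_i} t^{v_μ(i+1) - v_μ(i)}`. -/
noncomputable def a' {n : ℕ} (q th : ℂ) (i : Fin n) (μ : Fin (n + 1) → ℤ) : ℂ :=
  ratio q th μ i.succ i.castSucc

/-- `D_μ = (1 - t a_μ) (1 - t a_{s_i μ}) / ((1 - a_μ) (1 - a_{s_i μ}))`. -/
noncomputable def D {n : ℕ} (q th : ℂ) (i : Fin n) (μ : Fin (n + 1) → ℤ) : ℂ :=
  ((1 - th ^ 2 * a q th i μ) * (1 - th ^ 2 * a' q th i μ)) /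
    ((1 - a q th i μ) * (1 - a' q th i μ))

end Macdonald

/-! The relations among the `T i` come from the identity that defines `th • T th i f` after
multiplication by `x_i - x_{i+1}`. It determines `T th i f` because Laurent polynomials form a
domain, and over the fraction field the quadratic and braid relations become identities of rational
functions. The operator `g` is multiplicative and rotates the variables, so it carries `T_i` to
`T_{i+1}`, and `g * g` carries the last `T` to the first. From there the relations involving the
`Y_j` are formal consequences in a group (`IsAffineBraid`).

The `Y_j` are simultaneously triangular on monomials, for the order by Euclidean norm refined by a
linear form with increasing weights, and their diagonal entries are `eig` (`Y_mon_sub_mem`). The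
single `T_i` is not triangular for one order, but it is triangular from an order to its image under
`s_i`; the factorization `Y_j = V_j U_j` makes these changes of order cancel. Since genericity
separates the tuples of eigenvalues, killing all lower eigenvalues in `x^μ` produces a basis of
joint eigenvectors (`exists_eigenvector`), in which each joint eigenspace is a line. This gives
existence and uniqueness of `E_μ` and linear independence.

The action follows from the intertwining property: `τ_i E_μ` is a joint eigenvector, or zero, for
the tuple of `μ` with entries `i` and `i+1` exchanged (`Y_tau_E`). If `μ_i ≠ μ_{i+1}` this is the
tuple of `s_i μ`. For `μ_i > μ_{i+1}` a leading coefficient fixes the scalar, and the quadratic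
relation gives the way back. If `μ_i = μ_{i+1}` no `E_ν` has the exchanged tuple (`eig_swap_ne`), so
`τ_i E_μ = 0`. The formulas stay within orbits of `μ`, which yields the submodules. -/

namespace Macdonald

/-! ### Multiplicative operators on Laurent polynomials -/

theorem lhom_ext_mon {N : ℕ} {M : Type*} [AddCommMonoid M] [Module ℂ M]
    {A B : Laurent N →ₗ[ℂ] M} (h : ∀ μ, A (mon μ) = B (mon μ)) : A = B :=
  AddMonoidAlgebra.lhom_ext' fun μ => LinearMap.ext_ring (h μ)

theorem monLin_mul {N : ℕ} {φ : (Fin N → ℤ) → Laurent N}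
    (hφ : ∀ μ ν, φ (μ + ν) = φ μ * φ ν) (f h : Laurent N) :
    monLin φ (f * h) = monLin φ f * monLin φ h := by
  have key : (LinearMap.mul ℂ (Laurent N)).compr₂ (monLin φ) =
      (LinearMap.mul ℂ (Laurent N)).compl₁₂ (monLin φ) (monLin φ) := by
    refine lhom_ext_mon fun μ => lhom_ext_mon fun ν => ?_
    simp [mon_mul_mon, monLin_mon, hφ]
  exact LinearMap.congr_fun (LinearMap.congr_fun key f) h

/-- The constant Laurent polynomial. -/
noncomputable def cst (N : ℕ) (c : ℂ) : Laurent N := algebraMap ℂ (Laurent N) c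

theorem smul_eq_cst_mul {N : ℕ} (c : ℂ) (f : Laurent N) : c • f = cst N c * f :=
  Algebra.smul_def c f

theorem map_cst_mul {N : ℕ} (A : Module.End ℂ (Laurent N)) (c : ℂ) (f : Laurent N) :
    A (cst N c * f) = cst N c * A f := by
  rw [← smul_eq_cst_mul, map_smul, smul_eq_cst_mul]

theorem sOp_mon {n : ℕ} (i : Fin n) (μ : Fin (n + 1) → ℤ) : sOp i (mon μ) = mon (sAct i μ) :=
  monLin_mon _ _

theorem sOp_mul {n : ℕ} (i : Fin n) (f h : Laurent (n + 1)) :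
    sOp i (f * h) = sOp i f * sOp i h :=
  monLin_mul (fun μ ν => by rw [mon_mul_mon]; rfl) f h

theorem sOp_sOp {n : ℕ} (i : Fin n) (f : Laurent (n + 1)) : sOp i (sOp i f) = f := by
  have : sOp i * sOp i = 1 := lhom_ext_mon fun μ => by simp [sOp_mon, sAct_sAct]
  exact LinearMap.congr_fun this f

theorem sOp_X {n : ℕ} (i : Fin n) (j : Fin (n + 1)) :
    sOp i (X j) = X (Equiv.swap i.castSucc i.succ j) := by
  rw [X, sOp_mon, X, sAct]
  congr 1
  funext k
  by_cases h : k = Equiv.swap i.castSucc i.succ j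
  · subst h; simp
  · have : Equiv.swap i.castSucc i.succ k ≠ j := fun e => h (by rw [← e]; simp)
    simp [h, this]

theorem X_sub_X_ne_zero {N : ℕ} {j k : Fin N} (h : j ≠ k) : X j - X k ≠ 0 := by
  intro e
  have h1 := congrArg (fun f : Laurent N => f.coeff (Pi.single j 1)) (sub_eq_zero.mp e)
  have h2 : (Pi.single k 1 : Fin N → ℤ) ≠ Pi.single j 1 := fun h' => by
    have := congrFun h' j
    simp [h] at this
  simp [X, mon, h2] at h1

/-! ### The operators `T_i` -/

theorem X_sub_X_mul_T {n : ℕ} {th : ℂ} (hth : th ≠ 0) (i : Fin n) (f : Laurent (n + 1)) :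
    (X i.castSucc - X i.succ) * (th • T th i f) =
      (1 - cst _ (th ^ 2)) * X i.succ * f +
        (cst _ (th ^ 2) * X i.castSucc - X i.succ) * sOp i f := by
  have h := X_sub_X_mul_divDiff i f
  have e : th • T th i f = cst _ (th ^ 2) * f -
      (cst _ (th ^ 2) * X i.castSucc - X i.succ) * divDiff i f := by
    simp only [T, LinearMap.smul_apply, LinearMap.sub_apply, Module.End.one_apply,
      LinearMap.comp_apply, LinearMap.mulLeft_apply, smul_inv_smul₀ hth]
    rw [smul_eq_cst_mul, smul_eq_cst_mul]
  rw [e]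
  rw [mul_sub, mul_left_comm (X i.castSucc - X i.succ) (_ - _), h]
  ring

/-- Cancellation of `x_i - x_{i+1}` in a domain. This is how values of `T i` are recognised after an
algebra homomorphism has been applied to the defining identity. -/
theorem eq_smul_T_of_mul_eq {n : ℕ} {th : ℂ} (hth : th ≠ 0) (i : Fin n) {f h : Laurent (n + 1)}
    (e : (X i.castSucc - X i.succ) * h = (1 - cst _ (th ^ 2)) * X i.succ * f +
        (cst _ (th ^ 2) * X i.castSucc - X i.succ) * sOp i f) : h = th • T th i f :=
  mul_left_cancel₀ (X_sub_X_ne_zero (Fin.castSucc_lt_succ (i := i)).ne)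
    (e.trans (X_sub_X_mul_T hth i f).symm)

theorem T_quadratic {n : ℕ} {th : ℂ} (hth : th ≠ 0) (i : Fin n) :
    T th i * T th i = (th - th⁻¹) • T th i + 1 := by
  refine LinearMap.ext fun f => ?_
  have key : th • T th i (th • T th i f) =
      cst _ (th ^ 2 - 1) * (th • T th i f) + cst _ (th ^ 2) * f := by
    symm
    apply eq_smul_T_of_mul_eq hth
    -- Applying `s_i` to the identity for `A = th • T th i f` gives a second one for `s_i A`; the
    -- quadratic relation is a linear combination of the two.
    have h1 := X_sub_X_mul_T hth i f
    have h2 := congrArg (sOp i) h1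
    simp only [sOp_mul, map_add, map_sub, sOp_X, sOp_sOp, map_cst_mul, Equiv.swap_apply_left,
      Equiv.swap_apply_right, sub_mul, one_mul, mul_assoc] at h2
    have hc : cst (n + 1) (th ^ 2 - 1) = cst _ (th ^ 2) - 1 := by
      rw [cst, map_sub, map_one, cst]
    rw [hc]
    apply mul_left_cancel₀ (X_sub_X_ne_zero (Fin.castSucc_lt_succ (i := i)).ne)
    generalize sOp i (th • T th i f) = B at *
    generalize th • T th i f = A at *
    linear_combination (cst _ (th ^ 2) * X i.castSucc - X i.succ) * h2
      + (cst _ (th ^ 2) - 1) * X i.castSucc * h1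
  have h3 : th ^ 2 • (T th i * T th i) f =
      th ^ 2 • (((th - th⁻¹) • T th i + 1 : Module.End ℂ (Laurent (n + 1))) f) := by
    simp only [map_smul, ← smul_eq_cst_mul, smul_smul] at key
    simp only [Module.End.mul_apply, LinearMap.add_apply, LinearMap.smul_apply,
      Module.End.one_apply, smul_add, smul_smul, pow_two]
    rw [key, pow_two]
    congr 2
    field_simp
  exact smul_right_injective _ (pow_ne_zero 2 hth) h3

theorem isUnit_T {n : ℕ} {th : ℂ} (hth : th ≠ 0) (i : Fin n) : IsUnit (T th i) := by
  have h := T_quadratic hth i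
  refine ⟨⟨T th i, T th i - (th - th⁻¹) • 1, ?_, ?_⟩, rfl⟩
  · rw [mul_sub, h, mul_smul_comm, mul_one, add_sub_cancel_left]
  · rw [sub_mul, h, smul_mul_assoc, one_mul, add_sub_cancel_left]

theorem inverse_T {n : ℕ} {th : ℂ} (hth : th ≠ 0) (i : Fin n) :
    Ring.inverse (T th i) = T th i - (th - th⁻¹) • 1 := by
  have h := T_quadratic hth i
  have h2 := Ring.inverse_mul_cancel _ (isUnit_T hth i)
  calc Ring.inverse (T th i) = Ring.inverse (T th i) * (T th i * (T th i - (th - th⁻¹) • 1)) := by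
        rw [mul_sub, h, mul_smul_comm, mul_one, add_sub_cancel_left, mul_one]
    _ = _ := by rw [← mul_assoc, h2, one_mul]

theorem eq_of_smul_apply_eq {N : ℕ} {c : ℂ} (hc : c ≠ 0) {A B : Module.End ℂ (Laurent N)}
    (h : ∀ f, c • A f = c • B f) : A = B :=
  LinearMap.ext fun f => smul_right_injective _ hc (h f)

/-- Here `f1`, `f2`, `f12` stand for `s_i f`, `s_j f`, `s_i s_j f`; `A` and `A'` for `T_i f` and
`T_j f` up to scaling; `A2` and `A1'` for their images under `s_j` and `s_i`. With these as
independent symbols no group action is left, only an identity in a field. -/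
theorem field_far {K : Type*} [Field K] {t x y z w f f1 f2 f12 A A2 C A' A1' C' : K}
    (hxy : x - y ≠ 0) (hzw : z - w ≠ 0)
    (hA : (x - y) * A = (1 - t) * y * f + (t * x - y) * f1)
    (hA2 : (x - y) * A2 = (1 - t) * y * f2 + (t * x - y) * f12)
    (hC : (z - w) * C = (1 - t) * w * A + (t * z - w) * A2)
    (hA' : (z - w) * A' = (1 - t) * w * f + (t * z - w) * f2)
    (hA1' : (z - w) * A1' = (1 - t) * w * f1 + (t * z - w) * f12)
    (hC' : (x - y) * C' = (1 - t) * y * A' + (t * x - y) * A1') : C = C' := by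
  rw [mul_comm, ← eq_div_iff (by assumption)] at *
  subst hA hA2 hA' hA1' hC hC'
  field_simp
  ring

/-- The same device for three variables: `f, f1, f2, f12, f21, f121` are the six images of `f` under
the group generated by `s_i` and `s_j`. A digit after `A` or `B` records the reflections applied to
it, and primes mark the side that starts with `T_j`. -/
theorem field_braid {K : Type*} [Field K]
    {t x y z f f1 f2 f12 f21 f121 A A1 A2 A12 B B1 C A' A1' A2' A21' B' B2' C' : K}
    (hxy : x - y ≠ 0) (hyx : y - x ≠ 0) (hyz : y - z ≠ 0) (hzy : z - y ≠ 0) (hxz : x - z ≠ 0)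
    (hA : (x - y) * A = (1 - t) * y * f + (t * x - y) * f1)
    (hA1 : (y - x) * A1 = (1 - t) * x * f1 + (t * y - x) * f)
    (hA2 : (x - z) * A2 = (1 - t) * z * f2 + (t * x - z) * f21)
    (hA12 : (y - z) * A12 = (1 - t) * z * f12 + (t * y - z) * f121)
    (hB : (y - z) * B = (1 - t) * z * A + (t * y - z) * A2)
    (hB1 : (x - z) * B1 = (1 - t) * z * A1 + (t * x - z) * A12)
    (hC : (x - y) * C = (1 - t) * y * B + (t * x - y) * B1)
    (hA' : (y - z) * A' = (1 - t) * z * f + (t * y - z) * f2)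
    (hA1' : (x - z) * A1' = (1 - t) * z * f1 + (t * x - z) * f12)
    (hA2' : (z - y) * A2' = (1 - t) * y * f2 + (t * z - y) * f)
    (hA21' : (x - y) * A21' = (1 - t) * y * f21 + (t * x - y) * f121)
    (hB' : (x - y) * B' = (1 - t) * y * A' + (t * x - y) * A1')
    (hB2' : (x - z) * B2' = (1 - t) * z * A2' + (t * x - z) * A21')
    (hC' : (y - z) * C' = (1 - t) * z * B' + (t * y - z) * B2') : C = C' := by
  rw [mul_comm, ← eq_div_iff (by assumption)] at *
  -- Keeps one sign of each difference, so that every denominator is a product of `x - y`, `y - z`,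
  -- `x - z`.
  have e1 : y - x = -(x - y) := by ring
  have e2 : z - y = -(y - z) := by ring
  rw [e1, div_neg] at hA1
  rw [e2, div_neg] at hA2'
  subst hA hA1 hA2 hA12 hA' hA1' hA2' hA21' hB hB1 hB' hB2' hC hC'
  clear e1 e2
  field_simp
  ring

/-! ### The braid relations -/

/-- `A = ((1 - t) y f + (t x - y) f') / (x - y)`, without denominators. -/
def DL {R : Type*} [CommRing R] (t x y f f' A : R) : Prop :=
  (x - y) * A = (1 - t) * y * f + (t * x - y) * f'

theorem DL.map {R S : Type*} [CommRing R] [CommRing S] {t x y f f' A : R}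
    (h : DL t x y f f' A) (φ : R →+* S) : DL (φ t) (φ x) (φ y) (φ f) (φ f') (φ A) := by
  simpa [DL] using congrArg φ h

/-- The relation is homogeneous in the pair of variables. This absorbs the common factor `q⁻¹` that
`g * g` puts on the last two variables. -/
theorem DL.of_mul {R : Type*} [CommRing R] [IsDomain R] {c t x y f f' A : R} (hc : c ≠ 0)
    (h : DL t (c * x) (c * y) f f' A) : DL t x y f f' A := by
  refine mul_left_cancel₀ hc ?_
  unfold DL at h
  linear_combination h

theorem DL_T {n : ℕ} {th : ℂ} (hth : th ≠ 0) (i : Fin n) (f : Laurent (n + 1)) :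
    DL (cst _ (th ^ 2)) (X i.castSucc) (X i.succ) f (sOp i f) (th • T th i f) :=
  X_sub_X_mul_T hth i f

/-- `s_i` as a homomorphism of algebras. -/
noncomputable def sAlg {n : ℕ} (i : Fin n) : Laurent (n + 1) →ₐ[ℂ] Laurent (n + 1) :=
  AlgHom.ofLinearMap (sOp i) (by
    change sOp i (mon 0) = mon 0
    rw [sOp_mon]; rfl) (sOp_mul i)

theorem sAlg_cst {n : ℕ} (i : Fin n) (c : ℂ) : sAlg i (cst _ c) = cst _ c :=
  (sAlg i).commutes c

theorem DL.sOp {n : ℕ} {c : ℂ} {x y f f' A : Laurent (n + 1)} (h : DL (cst _ c) x y f f' A)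
    (i : Fin n) : DL (cst _ c) (sOp i x) (sOp i y) (sOp i f) (sOp i f') (sOp i A) := by
  have h' := h.map (sAlg i).toRingHom
  have e : (sAlg i).toRingHom (cst _ c) = cst _ c := sAlg_cst i c
  rw [e] at h'
  exact h'

theorem sOp_braid {n : ℕ} {i j : Fin n} (hij : (i : ℕ) + 1 = j) (f : Laurent (n + 1)) :
    sOp i (sOp j (sOp i f)) = sOp j (sOp i (sOp j f)) := by
  have hb : j.castSucc = i.succ := Fin.ext (by simp [hij])
  have hs : Equiv.swap i.castSucc i.succ * Equiv.swap j.castSucc j.succ *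
      Equiv.swap i.castSucc i.succ = Equiv.swap j.castSucc j.succ *
      Equiv.swap i.castSucc i.succ * Equiv.swap j.castSucc j.succ := by
    have h1 : i.castSucc ≠ i.succ := (Fin.castSucc_lt_succ (i := i)).ne
    have h2 : j.succ ≠ i.succ := by rw [← hb]; exact (Fin.castSucc_lt_succ (i := j)).ne'
    have h3 : i.castSucc ≠ j.succ := fun e => by
      have := congrArg Fin.val e; simp at this; omega
    rw [hb, Equiv.swap_mul_swap_mul_swap h1 h3, Equiv.swap_comm i.castSucc i.succ,
      Equiv.swap_comm i.succ j.succ, Equiv.swap_mul_swap_mul_swap h2 h3.symm,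
      Equiv.swap_comm]
  have : (sOp i * sOp j * sOp i : Module.End ℂ (Laurent (n + 1))) = sOp j * sOp i * sOp j := by
    refine lhom_ext_mon fun μ => ?_
    simp only [Module.End.mul_apply, sOp_mon]
    congr 1
    funext k
    exact congrArg μ (Equiv.congr_fun hs k)
  exact LinearMap.congr_fun this f

theorem sOp_comm {n : ℕ} {i j : Fin n} (hij : (i : ℕ) + 1 < j) (f : Laurent (n + 1)) :
    sOp i (sOp j f) = sOp j (sOp i f) := by
  have hs : Equiv.swap i.castSucc i.succ * Equiv.swap j.castSucc j.succ =
      Equiv.swap j.castSucc j.succ * Equiv.swap i.castSucc i.succ := by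
    refine (Equiv.Perm.disjoint_swap_swap ?_).commute
    simp [Fin.ext_iff]; omega
  have : (sOp i * sOp j : Module.End ℂ (Laurent (n + 1))) = sOp j * sOp i := by
    refine lhom_ext_mon fun μ => ?_
    simp only [Module.End.mul_apply, sOp_mon]
    congr 1
    funext k
    exact (congrArg μ (Equiv.congr_fun hs k)).symm
  exact LinearMap.congr_fun this f

theorem sOp_X_of_ne {n : ℕ} {i : Fin n} {j : Fin (n + 1)} (h1 : j ≠ i.castSucc)
    (h2 : j ≠ i.succ) : sOp i (X j) = X j := by
  rw [sOp_X, Equiv.swap_apply_of_ne_of_ne h1 h2]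

theorem map_X_sub_X_ne_zero {N : ℕ} {j k : Fin N} (h : j ≠ k) :
    algebraMap (Laurent N) (FractionRing (Laurent N)) (X j) -
      algebraMap (Laurent N) (FractionRing (Laurent N)) (X k) ≠ 0 := by
  rw [← map_sub]
  exact (map_ne_zero_iff _ (IsFractionRing.injective _ _)).mpr (X_sub_X_ne_zero h)

theorem T_far {n : ℕ} {th : ℂ} (hth : th ≠ 0) {i j : Fin n} (hij : (i : ℕ) + 1 < j) :
    T th i * T th j = T th j * T th i := by
  refine eq_of_smul_apply_eq (pow_ne_zero 2 hth) fun f => ?_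
  have hx : sOp j (X i.castSucc : Laurent (n + 1)) = X i.castSucc :=
    sOp_X_of_ne (by simp [Fin.ext_iff]; omega) (by simp [Fin.ext_iff]; omega)
  have hy : sOp j (X i.succ : Laurent (n + 1)) = X i.succ :=
    sOp_X_of_ne (by simp [Fin.ext_iff]; omega) (by simp [Fin.ext_iff]; omega)
  have hz : sOp i (X j.castSucc : Laurent (n + 1)) = X j.castSucc :=
    sOp_X_of_ne (by simp [Fin.ext_iff]; omega) (by simp [Fin.ext_iff]; omega)
  have hw : sOp i (X j.succ : Laurent (n + 1)) = X j.succ :=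
    sOp_X_of_ne (by simp [Fin.ext_iff]; omega) (by simp [Fin.ext_iff]; omega)
  have hA := DL_T hth i f
  have hA2 := hA.sOp j
  have hC := DL_T hth j (th • T th i f)
  have hA' := DL_T hth j f
  have hA1' := hA'.sOp i
  have hC' := DL_T hth i (th • T th j f)
  rw [hx, hy, ← sOp_comm hij] at hA2
  rw [hz, hw] at hA1'
  have key : th • T th j (th • T th i f) = th • T th i (th • T th j f) := by
    refine IsFractionRing.injective (Laurent (n + 1)) (FractionRing (Laurent (n + 1))) ?_
    let φ := algebraMap (Laurent (n + 1)) (FractionRing (Laurent (n + 1)))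
    exact field_far (map_X_sub_X_ne_zero (Fin.castSucc_lt_succ (i := i)).ne)
      (map_X_sub_X_ne_zero (Fin.castSucc_lt_succ (i := j)).ne)
      (hA.map φ) (hA2.map φ) (hC.map φ) (hA'.map φ) (hA1'.map φ) (hC'.map φ)
  simp only [map_smul, smul_smul] at key
  rw [Module.End.mul_apply, Module.End.mul_apply, pow_two, key]

theorem T_braid {n : ℕ} {th : ℂ} (hth : th ≠ 0) {i j : Fin n} (hij : (i : ℕ) + 1 = j) :
    T th i * T th j * T th i = T th j * T th i * T th j := by
  refine eq_of_smul_apply_eq (pow_ne_zero 3 hth) fun f => ?_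
  have hb : j.castSucc = i.succ := Fin.ext (by simp [hij])
  have hne1 : i.castSucc ≠ i.succ := (Fin.castSucc_lt_succ (i := i)).ne
  have hne2 : i.succ ≠ j.succ := by rw [← hb]; exact (Fin.castSucc_lt_succ (i := j)).ne
  have hne3 : i.castSucc ≠ j.succ := by simp [Fin.ext_iff]; omega
  have hix : sOp i (X i.castSucc) = X i.succ := by rw [sOp_X, Equiv.swap_apply_left]
  have hiy : sOp i (X i.succ) = X i.castSucc := by rw [sOp_X, Equiv.swap_apply_right]
  have hiz : sOp i (X j.succ : Laurent (n + 1)) = X j.succ := sOp_X_of_ne hne3.symm hne2.symm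
  have hjx : sOp j (X i.castSucc : Laurent (n + 1)) = X i.castSucc :=
    sOp_X_of_ne (hb ▸ hne1) hne3
  have hjy : sOp j (X i.succ) = X j.succ := by rw [← hb, sOp_X, Equiv.swap_apply_left]
  have hjz : sOp j (X j.succ) = X i.succ := by rw [sOp_X, Equiv.swap_apply_right, hb]
  have hi := fun f => DL_T hth i f
  have hj := fun f => DL_T hth j f
  rw [hb] at hj
  have hA := hi f
  have hA1 := hA.sOp i
  have hA2 := hA.sOp j
  have hA12 := hA2.sOp i
  have hB := hj (th • T th i f)
  have hB1 := hB.sOp i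
  have hC := hi (th • T th j (th • T th i f))
  have hA' := hj f
  have hA1' := hA'.sOp i
  have hA2' := hA'.sOp j
  have hA21' := hA1'.sOp j
  have hB' := hi (th • T th j f)
  have hB2' := hB'.sOp j
  have hC' := hj (th • T th i (th • T th j f))
  -- Normal form: rewriting `s_j s_i s_j` as `s_i s_j s_i` leaves just the six images of `f` named
  -- in `field_braid`.
  simp only [hix, hiy, hiz, hjx, hjy, hjz, sOp_sOp, ← sOp_braid hij] at *
  have key : th • T th i (th • T th j (th • T th i f)) =
      th • T th j (th • T th i (th • T th j f)) := by
    refine IsFractionRing.injective (Laurent (n + 1)) (FractionRing (Laurent (n + 1))) ?_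
    let φ := algebraMap (Laurent (n + 1)) (FractionRing (Laurent (n + 1)))
    exact field_braid (map_X_sub_X_ne_zero hne1) (map_X_sub_X_ne_zero hne1.symm)
      (map_X_sub_X_ne_zero hne2) (map_X_sub_X_ne_zero hne2.symm) (map_X_sub_X_ne_zero hne3)
      (hA.map φ) (hA1.map φ) (hA2.map φ) (hA12.map φ) (hB.map φ) (hB1.map φ) (hC.map φ)
      (hA'.map φ) (hA1'.map φ) (hA2'.map φ) (hA21'.map φ) (hB'.map φ) (hB2'.map φ) (hC'.map φ)
  simp only [map_smul, smul_smul] at key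
  simp only [Module.End.mul_apply, pow_succ, pow_zero, one_mul, mul_assoc, key]

/-! ### The operator `g` -/

/-- Extension of a finite family by `1`. -/
def nExt {n : ℕ} {A : Type*} [One A] (f : Fin n → A) (i : ℕ) : A :=
  if h : i < n then f ⟨i, h⟩ else 1

theorem nExt_of_lt {n : ℕ} {A : Type*} [One A] (f : Fin n → A) {i : ℕ} (h : i < n) :
    nExt f i = f ⟨i, h⟩ := dif_pos h

theorem ofFn_eq_map_nExt {n : ℕ} {A : Type*} [One A] (f : Fin n → A) :
    List.ofFn f = (List.range' 0 n).map (nExt f) := by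
  refine List.ext_getElem (by simp) fun i h1 h2 => ?_
  simp at h1
  simp [nExt_of_lt f h1]

/-- The cyclic rotation `(μ₁, …, μ_{n+1}) ↦ (μ_{n+1}, μ₁, …, μ_n)`. -/
def rot {n : ℕ} (μ : Fin (n + 1) → ℤ) : Fin (n + 1) → ℤ := Fin.cons (μ (Fin.last n)) (Fin.init μ)

theorem rot_zero {n : ℕ} (μ : Fin (n + 1) → ℤ) : rot μ 0 = μ (Fin.last n) := rfl

theorem rot_succ {n : ℕ} (μ : Fin (n + 1) → ℤ) (i : Fin n) : rot μ i.succ = μ i.castSucc := rfl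

/-- Induction from the right end: each tail of the product of reflections is a cycle on the
positions from `k` on. The case `k = 0` is the rotation in `g`. -/
theorem prod_range'_sOp_mon {n : ℕ} (m k : ℕ) (h : k + m = n) (μ : Fin (n + 1) → ℤ) :
    ((List.range' k m).map (nExt fun i : Fin n => sOp i)).prod (mon μ) =
      mon fun l => if (l : ℕ) < k then μ l else if (l : ℕ) = k then μ (Fin.last n) else
        μ ⟨l - 1, by omega⟩ := by
  induction m generalizing k with
  | zero =>
    simp only [List.range'_zero, List.map_nil, List.prod_nil, Module.End.one_apply]
    congr 1
    funext l
    split_ifs with h1 h2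
    · rfl
    · congr 1; exact Fin.ext (by simp; omega)
    · omega
  | succ m ih =>
    have hk : k < n := by omega
    rw [List.range'_succ, List.map_cons, List.prod_cons, Module.End.mul_apply,
      ih (k + 1) (by omega), nExt_of_lt _ hk, sOp_mon]
    congr 1
    funext l
    simp only [sAct, Function.comp]
    by_cases h1 : l = Fin.castSucc ⟨k, hk⟩
    · subst h1; simp
    · by_cases h2 : l = Fin.succ ⟨k, hk⟩
      · subst h2; simp
      · rw [Equiv.swap_apply_of_ne_of_ne h1 h2]
        simp only [Fin.ext_iff, Fin.val_castSucc, Fin.val_succ] at h1 h2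
        by_cases h3 : (l : ℕ) < k
        · simp [h3, Nat.lt_succ_of_lt h3]
        · simp [h3, h1, h2, show ¬ (l : ℕ) < k + 1 by omega]

theorem g_mon {n : ℕ} (q : ℂ) (μ : Fin (n + 1) → ℤ) :
    g q (mon μ) = q ^ (-μ (Fin.last n)) • mon (rot μ) := by
  rw [g, Module.End.mul_apply, qShift, monLin_mon, map_smul, ofFn_eq_map_nExt,
    prod_range'_sOp_mon n 0 (by simp)]
  congr 2
  funext l
  refine Fin.cases ?_ (fun i => ?_) l
  · simp [rot_zero]
  · rw [rot_succ]
    simp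
    rfl

theorem g_eq_monLin {n : ℕ} (q : ℂ) :
    g (n := n) q = monLin fun μ => q ^ (-μ (Fin.last n)) • mon (rot μ) :=
  lhom_ext_mon fun μ => by rw [g_mon, monLin_mon]

theorem rot_add {n : ℕ} (μ ν : Fin (n + 1) → ℤ) : rot (μ + ν) = rot μ + rot ν := by
  funext l
  refine Fin.cases ?_ (fun i => ?_) l
  · rfl
  · rfl

/-- `g` as a homomorphism of algebras. -/
noncomputable def gAlg {n : ℕ} {q : ℂ} (hq : q ≠ 0) : Laurent (n + 1) →ₐ[ℂ] Laurent (n + 1) :=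
  AlgHom.ofLinearMap (g q) (by
    change g q (mon 0) = mon 0
    rw [g_mon]
    have : rot (0 : Fin (n + 1) → ℤ) = 0 := by
      funext l
      refine Fin.cases ?_ (fun i => ?_) l
      · rfl
      · rfl
    simp [this]) (by
    rw [g_eq_monLin]
    refine monLin_mul fun μ ν => ?_
    rw [rot_add, ← mon_mul_mon, smul_mul_smul_comm, ← zpow_add₀ hq, Pi.add_apply, neg_add])

theorem gAlg_cst {n : ℕ} {q : ℂ} (hq : q ≠ 0) (c : ℂ) :
    gAlg (n := n) hq (cst _ c) = cst _ c :=
  (gAlg hq).commutes c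

theorem DL.g {n : ℕ} {q : ℂ} (hq : q ≠ 0) {c : ℂ} {x y f f' A : Laurent (n + 1)}
    (h : DL (cst _ c) x y f f' A) :
    DL (cst _ c) (g q x) (g q y) (g q f) (g q f') (g q A) := by
  have h' := h.map (gAlg hq).toRingHom
  have e : (gAlg hq).toRingHom (cst (n + 1) c) = cst _ c := gAlg_cst hq c
  rw [e] at h'
  exact h'

theorem g_X_castSucc {n : ℕ} (q : ℂ) (i : Fin n) : g q (X i.castSucc) = X i.succ := by
  rw [X, g_mon, X]
  have h1 : (Pi.single i.castSucc 1 : Fin (n + 1) → ℤ) (Fin.last n) = 0 := by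
    rw [Pi.single_eq_of_ne (Fin.castSucc_lt_last i).ne']
  rw [h1, neg_zero, zpow_zero, one_smul]
  congr 1
  funext l
  refine Fin.cases ?_ (fun j => ?_) l
  · rw [rot_zero, h1, Pi.single_eq_of_ne (Fin.succ_ne_zero i).symm]
  · rw [rot_succ]; simp [Pi.single_apply]

theorem g_X_last {n : ℕ} (q : ℂ) :
    g q (X (Fin.last n)) = cst _ q⁻¹ * X 0 := by
  rw [X, g_mon, X, ← smul_eq_cst_mul]
  congr 1
  · simp
  · congr 1
    funext l
    refine Fin.cases ?_ (fun j => ?_) l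
    · rw [rot_zero]; simp
    · rw [rot_succ, Pi.single_eq_of_ne (Fin.castSucc_lt_last j).ne,
        Pi.single_eq_of_ne (Fin.succ_ne_zero j)]

theorem rot_sAct {n : ℕ} {i j : Fin n} (hij : (i : ℕ) + 1 = j) (μ : Fin (n + 1) → ℤ) :
    rot (sAct i μ) = sAct j (rot μ) := by
  have hb : i.succ = j.castSucc := Fin.ext (by simp [hij])
  funext l
  refine Fin.cases ?_ (fun k => ?_) l
  · rw [rot_zero, sAct, sAct, Function.comp, Function.comp, Equiv.swap_apply_of_ne_of_ne,
      Equiv.swap_apply_of_ne_of_ne, rot_zero]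
    all_goals simp [Fin.ext_iff]; try omega
  · rw [rot_succ, sAct, sAct, Function.comp, Function.comp]
    by_cases h1 : k = i
    · subst h1
      rw [Equiv.swap_apply_left, hb, Equiv.swap_apply_left, rot_succ]
    · by_cases h2 : k = j
      · subst h2
        rw [← hb, Equiv.swap_apply_right, Equiv.swap_apply_right, rot_succ]
      · rw [Equiv.swap_apply_of_ne_of_ne, Equiv.swap_apply_of_ne_of_ne, rot_succ]
        all_goals simp only [ne_eq, Fin.ext_iff, Fin.val_succ, Fin.val_castSucc] at *; omega

theorem sAct_last {n : ℕ} {i : Fin n} (hi : (i : ℕ) + 1 < n) (μ : Fin (n + 1) → ℤ) :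
    sAct i μ (Fin.last n) = μ (Fin.last n) := by
  rw [sAct, Function.comp, Equiv.swap_apply_of_ne_of_ne]
  all_goals simp [Fin.ext_iff]; omega

theorem g_sOp {n : ℕ} (q : ℂ) {i j : Fin n} (hij : (i : ℕ) + 1 = j) (f : Laurent (n + 1)) :
    g q (sOp i f) = sOp j (g q f) := by
  have : g q * sOp i = sOp j * g q := lhom_ext_mon fun μ => by
    rw [Module.End.mul_apply, Module.End.mul_apply, sOp_mon, g_mon, g_mon, map_smul, sOp_mon,
      rot_sAct hij, sAct_last (by omega)]
  exact LinearMap.congr_fun this f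

theorem rot_rot_sAct {n : ℕ} (μ : Fin (n + 1 + 1) → ℤ) :
    rot (rot (sAct (Fin.last n) μ)) = sAct 0 (rot (rot μ)) := by
  funext l
  refine Fin.cases ?_ (fun k => Fin.cases ?_ (fun k' => ?_) k) l
  · simp only [sAct, Function.comp, Fin.castSucc_zero, Equiv.swap_apply_left]
    rw [rot_succ, Fin.castSucc_zero, rot_zero, rot_zero, ← Fin.succ_last, rot_succ]
    simp
  · simp only [sAct, Function.comp, Fin.castSucc_zero, Equiv.swap_apply_right]
    rw [rot_succ, Fin.castSucc_zero, rot_zero, rot_zero, ← Fin.succ_last, rot_succ]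
    simp
  · rw [rot_succ, ← Fin.succ_castSucc, rot_succ, sAct, sAct, Function.comp, Function.comp,
      Equiv.swap_apply_of_ne_of_ne, Equiv.swap_apply_of_ne_of_ne, rot_succ, ← Fin.succ_castSucc,
      rot_succ]
    all_goals simp [Fin.ext_iff]; try omega

/-- Two rotations bring the last two positions to the front. Both pick up their power of `q`, so the
total factor is symmetric in them; after a single `g` it would not be. -/
theorem g_g_sOp {n : ℕ} {q : ℂ} (hq : q ≠ 0) (f : Laurent (n + 1 + 1)) :
    g q (g q (sOp (Fin.last n) f)) = sOp 0 (g q (g q f)) := by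
  have : g q * g q * sOp (Fin.last n) = sOp 0 * g q * g q := lhom_ext_mon fun μ => by
    simp only [Module.End.mul_apply, sOp_mon, g_mon, map_smul, smul_smul, rot_rot_sAct]
    congr 1
    rw [← zpow_add₀ hq, ← zpow_add₀ hq, ← Fin.succ_last, rot_succ, rot_succ]
    simp only [sAct, Function.comp, Fin.succ_last, Equiv.swap_apply_left]
    rw [Equiv.swap_apply_right]
    congr 1
    ring
  exact LinearMap.congr_fun this f

theorem g_T {n : ℕ} {q th : ℂ} (hq : q ≠ 0) (hth : th ≠ 0) {i j : Fin n}
    (hij : (i : ℕ) + 1 = j) : g q * T th i = T th j * g q := by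
  refine eq_of_smul_apply_eq hth fun f => ?_
  have hb : i.succ = j.castSucc := Fin.ext (by simp [hij])
  have h := (DL_T hth i f).g hq
  rw [g_sOp q hij, g_X_castSucc, hb, g_X_castSucc] at h
  rw [Module.End.mul_apply, Module.End.mul_apply, ← map_smul]
  exact eq_smul_T_of_mul_eq hth j h

theorem g_g_T {n : ℕ} {q th : ℂ} (hq : q ≠ 0) (hth : th ≠ 0) :
    g q * g q * T th (Fin.last n) = T th 0 * (g q * g q) := by
  refine eq_of_smul_apply_eq hth fun f => ?_
  have h := ((DL_T hth (Fin.last n) f).g hq).g hq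
  have e0 : g q (X 0 : Laurent (n + 1 + 1)) = X (Fin.succ 0) := by
    rw [← Fin.castSucc_zero, g_X_castSucc]
  have hc : cst (n + 1 + 1) q⁻¹ ≠ 0 :=
    (map_ne_zero_iff _ (algebraMap ℂ (Laurent (n + 1 + 1))).injective).mpr (inv_ne_zero hq)
  rw [g_g_sOp hq, g_X_castSucc, Fin.succ_last, g_X_last, map_cst_mul, e0] at h
  rw [Module.End.mul_apply, Module.End.mul_apply, Module.End.mul_apply, Module.End.mul_apply,
    ← map_smul, ← map_smul]
  exact eq_smul_T_of_mul_eq hth 0 (h.of_mul hc)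

theorem isUnit_g {n : ℕ} {q : ℂ} (hq : q ≠ 0) : IsUnit (g (n := n) q) := by
  refine IsUnit.mul ?_ ?_
  · refine List.prod_isUnit fun A hA => ?_
    obtain ⟨i, rfl⟩ := (List.mem_ofFn' _ _).mp hA
    exact ⟨⟨sOp i, sOp i, LinearMap.ext (sOp_sOp i), LinearMap.ext (sOp_sOp i)⟩, rfl⟩
  · refine ⟨⟨qShift q, monLin fun μ => q ^ μ (Fin.last n) • mon μ, ?_, ?_⟩, rfl⟩
    all_goals
      refine lhom_ext_mon fun μ => ?_
      simp only [qShift, Module.End.mul_apply, monLin_mon, map_smul, smul_smul,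
        ← zpow_add₀ hq, Module.End.one_apply]
      simp

/-! ### The affine braid group -/

section Braid

variable {G : Type*} [Group G]

/-- Braid relations for `T 0, …, T (n - 1)`, and conjugation of them by `g`. -/
structure IsAffineBraid (n : ℕ) (T : ℕ → G) (g : G) : Prop where
  braid : ∀ i, i + 1 < n → T i * T (i + 1) * T i = T (i + 1) * T i * T (i + 1)
  far : ∀ i j, i + 1 < j → j < n → Commute (T i) (T j)
  rotate : ∀ i, i + 1 < n → SemiconjBy g (T i) (T (i + 1))
  rotate_last : ∀ m, n = m + 1 → SemiconjBy (g * g) (T m) (T 0)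

/-- The descending product `T (k + m - 1) ⋯ T k`. -/
def desc (T : ℕ → G) : ℕ → ℕ → G
  | _, 0 => 1
  | k, m + 1 => desc T (k + 1) m * T k

theorem desc_succ_top (T : ℕ → G) (k m : ℕ) : desc T k (m + 1) = T (k + m) * desc T k m := by
  induction m generalizing k with
  | zero => simp [desc]
  | succ m ih =>
    rw [desc, ih (k + 1), desc, mul_assoc, show k + 1 + m = k + (m + 1) by ring]

/-- `Y_1 = g T_n ⋯ T_1` and `Y_{i+1} = T_i⁻¹ Y_i T_i⁻¹`, in a group. -/
def braidY (n : ℕ) (T : ℕ → G) (g : G) : ℕ → G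
  | 0 => g * desc T 0 n
  | k + 1 => (T k)⁻¹ * braidY n T g k * (T k)⁻¹

namespace IsAffineBraid

variable {n : ℕ} {T : ℕ → G} {g : G} (h : IsAffineBraid n T g)
include h

theorem commute_desc (i k m : ℕ) (hik : i + 1 < k) (hkm : k + m ≤ n) :
    Commute (T i) (desc T k m) := by
  induction m generalizing k with
  | zero => exact Commute.one_right _
  | succ m ih =>
    exact (ih (k + 1) (by omega) (by omega)).mul_right (h.far i k hik (by omega))

/-- `T (j+1)` commutes with every factor except the adjacent pair `T (j+1) * T j`, and there the
braid relation turns it into `T j`. -/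
theorem desc_semiconj (j k m : ℕ) (hkj : k ≤ j) (hj : j + 1 < k + m) (hkm : k + m ≤ n) :
    SemiconjBy (desc T k m) (T (j + 1)) (T j) := by
  induction m generalizing k with
  | zero => omega
  | succ m ih =>
    rcases hkj.eq_or_lt with rfl | hlt
    · obtain ⟨m, rfl⟩ : ∃ m', m = m' + 1 := ⟨m - 1, by omega⟩
      have hc := h.commute_desc k (k + 2) m (by omega) (by omega)
      have hb := h.braid k (by omega)
      have e : desc T k (m + 1 + 1) = desc T (k + 2) m * (T (k + 1) * T k) := by
        rw [desc, desc, mul_assoc]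
      rw [SemiconjBy, e, mul_assoc, ← hb, ← mul_assoc, ← mul_assoc, ← hc.eq]
      simp only [mul_assoc]
    · exact (ih (k + 1) hlt (by omega) (by omega)).mul_left
        (h.far k (j + 1) (by omega) (by omega))

theorem desc_semiconj_desc (k m : ℕ) (hkm : k + m < n) :
    SemiconjBy (desc T 0 n) (desc T (k + 1) m) (desc T k m) := by
  induction m generalizing k with
  | zero => exact SemiconjBy.one_right _
  | succ m ih =>
    exact (ih (k + 1) (by omega)).mul_right
      (h.desc_semiconj k 0 n (Nat.zero_le _) (by omega) (by omega))

theorem g_semiconj_desc (k m : ℕ) (hkm : k + m < n) :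
    SemiconjBy g (desc T k m) (desc T (k + 1) m) := by
  induction m generalizing k with
  | zero => exact SemiconjBy.one_right _
  | succ m ih => exact (ih (k + 1) (by omega)).mul_right (h.rotate k (by omega))

/-- The descending product lowers the index by one and `g` raises it again. -/
theorem commute_Y_zero (j : ℕ) (hj : j + 1 < n) : Commute (T (j + 1)) (braidY n T g 0) :=
  ((h.rotate j hj).mul_left
    (h.desc_semiconj j 0 n (Nat.zero_le _) (by omega) (by omega)) :
      SemiconjBy (braidY n T g 0) _ _).eq.symm

/-- With `Z = g T_m ⋯ T_1` (indices from `0`), the two elements are `Z * T 0` and `(T 0)⁻¹ * Z`, so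
they commute exactly when `Z * Z` commutes with `T 0`. Moving the second `g` to the left writes `Z *
Z` as `g * g` times two descending products: the products carry `T 0` to `T m`, and `g * g` carries
it back. -/
theorem commute_Y_zero_one (hn : 0 < n) : Commute (braidY n T g 0) (braidY n T g 1) := by
  obtain ⟨m, rfl⟩ : ∃ m, n = m + 1 := ⟨n - 1, by omega⟩
  set Z := g * desc T 1 m with hZ
  have h0 : braidY (m + 1) T g 0 = Z * T 0 := by rw [braidY, desc, hZ, mul_assoc]
  have h1 : braidY (m + 1) T g 1 = (T 0)⁻¹ * Z := by
    rw [braidY, h0]; group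
  have hZZ : Z * Z = g * g * (desc T 0 m * desc T 1 m) := by
    have := (h.g_semiconj_desc 0 m (by omega)).eq
    rw [hZ, mul_assoc g, ← mul_assoc _ g, ← this]
    simp only [mul_assoc]
  have hd : SemiconjBy (desc T 0 m * desc T 1 m) (T 0) (T m) := by
    have h2 := (h.desc_semiconj_desc 0 m (by omega)).eq
    have h3 := desc_succ_top T 0 m
    rw [zero_add] at h3 h2
    rw [SemiconjBy, mul_assoc, ← mul_assoc (T m), ← h3, h2, desc]
  have hc : SemiconjBy (Z * Z) (T 0) (T 0) := by
    rw [hZZ]; exact (h.rotate_last m rfl).mul_left hd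
  rw [Commute, SemiconjBy, h0, h1]
  have := hc.eq
  calc Z * T 0 * ((T 0)⁻¹ * Z) = Z * Z := by group
    _ = (T 0)⁻¹ * (T 0 * (Z * Z)) := by group
    _ = (T 0)⁻¹ * (Z * Z * T 0) := by rw [this]
    _ = (T 0)⁻¹ * Z * (Z * T 0) := by group

theorem commute_Y_lt (i j : ℕ) (hij : i < j) (hj : j < n) :
    Commute (T j) (braidY n T g i) := by
  induction i with
  | zero =>
    obtain ⟨j, rfl⟩ : ∃ j', j = j' + 1 := ⟨j - 1, by omega⟩
    exact h.commute_Y_zero j hj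
  | succ i ih =>
    have hc := (h.far i j hij hj).symm.inv_right
    exact (hc.mul_right (ih (by omega))).mul_right hc

theorem commute_Y_gt (i j : ℕ) (hij : i + 1 < j) (hj : j ≤ n) :
    Commute (T i) (braidY n T g j) := by
  induction j with
  | zero => omega
  | succ j ih =>
    rcases (Nat.le_of_lt_succ hij).eq_or_lt with rfl | hlt
    · have hb := h.braid i (by omega)
      have hc := h.commute_Y_lt i (i + 1) (by omega) (by omega)
      -- Read from the right: `T i` becomes `T (i+1)`, which commutes with `Y_i`, and then becomes
      -- `T i` again.
      have e : braidY n T g (i + 1 + 1) =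
          (T i * T (i + 1))⁻¹ * braidY n T g i * (T (i + 1) * T i)⁻¹ := by
        rw [braidY, braidY]; group
      have hs1 : SemiconjBy (T i * T (i + 1)) (T i) (T (i + 1)) := by
        rw [SemiconjBy, hb, mul_assoc]
      have hs2 : SemiconjBy (T (i + 1) * T i) (T (i + 1)) (T i) := by
        rw [SemiconjBy, ← hb, mul_assoc]
      rw [e]
      have hs := (hs1.inv_symm_left.mul_left (hc : SemiconjBy _ _ _).symm).mul_left
        hs2.inv_symm_left
      exact hs.eq.symm
    · have hc := (h.far i j hlt (by omega)).inv_right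
      exact (hc.mul_right (ih hlt (by omega))).mul_right hc

theorem commute_T_Y (i j : ℕ) (hi : i < n) (hj : j ≤ n) (h1 : j ≠ i) (h2 : j ≠ i + 1) :
    Commute (T i) (braidY n T g j) := by
  rcases h1.lt_or_gt with hlt | hgt
  · exact h.commute_Y_lt j i hlt hi
  · exact h.commute_Y_gt i j (by omega) hj

/-- Only the pair `0, 1` uses `rotate_last`. Beyond it, the `T j` used to form the next `Y` already
commutes with `Y_0`. -/
theorem commute_Y_zero_Y (j : ℕ) (hj : j ≤ n) : Commute (braidY n T g 0) (braidY n T g j) := by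
  induction j with
  | zero => exact Commute.refl _
  | succ j ih =>
    rcases Nat.eq_zero_or_pos j with rfl | hpos
    · exact h.commute_Y_zero_one (by omega)
    · have hc := (h.commute_Y_lt 0 j hpos (by omega)).symm.inv_right
      exact (hc.mul_right (ih (by omega))).mul_right hc

theorem commute_Y_of_lt (i j : ℕ) (hij : i < j) (hj : j ≤ n) :
    Commute (braidY n T g i) (braidY n T g j) := by
  induction i with
  | zero => exact h.commute_Y_zero_Y j hj
  | succ i ih =>
    have hc := (h.commute_T_Y i j (by omega) hj (by omega) (by omega)).inv_left
    exact (hc.mul_left (ih (by omega))).mul_left hc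

theorem commute_Y (i j : ℕ) (hi : i ≤ n) (hj : j ≤ n) :
    Commute (braidY n T g i) (braidY n T g j) := by
  rcases lt_trichotomy i j with hlt | rfl | hgt
  · exact h.commute_Y_of_lt i j hlt hj
  · exact Commute.refl _
  · exact (h.commute_Y_of_lt j i hgt hi).symm

end IsAffineBraid

end Braid

/-! ### The affine Hecke algebra relations -/

theorem prod_reverse_eq_desc {A : Type*} [Monoid A] (T : ℕ → Aˣ) (f : ℕ → A) (k m : ℕ)
    (h : ∀ i, k ≤ i → i < k + m → f i = T i) :
    ((List.range' k m).map f).reverse.prod = (desc T k m : Aˣ) := by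
  induction m generalizing k with
  | zero => simp [desc]
  | succ m ih =>
    rw [List.range'_succ, List.map_cons, List.reverse_cons, List.prod_append,
      ih (k + 1) fun i h1 h2 => h i (by omega) (by omega)]
    simp [desc, h k le_rfl (by omega)]

section

variable {n : ℕ} {q th : ℂ}

/-- The unit `T_i` of the algebra of operators. -/
noncomputable def TUnit (hth : th ≠ 0) (i : Fin n) : (Module.End ℂ (Laurent (n + 1)))ˣ :=
  (isUnit_T hth i).unit

theorem val_nExt_TUnit (hth : th ≠ 0) {i : ℕ} (hi : i < n) :
    Units.val (nExt (TUnit (n := n) hth) i) = T th ⟨i, hi⟩ := by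
  rw [nExt_of_lt _ hi]; rfl

theorem isAffineBraid (hq : q ≠ 0) (hth : th ≠ 0) :
    IsAffineBraid n (nExt (TUnit hth)) (isUnit_g (n := n) hq).unit where
  braid i hi := by
    ext1
    rw [Units.val_mul, Units.val_mul, Units.val_mul, Units.val_mul,
      val_nExt_TUnit hth hi, val_nExt_TUnit hth (Nat.lt_of_succ_lt hi)]
    exact T_braid hth rfl
  far i j hij hj := by
    ext1
    rw [Units.val_mul, Units.val_mul, val_nExt_TUnit hth hj,
      val_nExt_TUnit hth (show i < n by omega)]
    exact T_far hth hij
  rotate i hi := by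
    ext1
    rw [Units.val_mul, Units.val_mul, val_nExt_TUnit hth hi,
      val_nExt_TUnit hth (Nat.lt_of_succ_lt hi), IsUnit.unit_spec]
    exact g_T hq hth rfl
  rotate_last m hm := by
    subst hm
    ext1
    rw [Units.val_mul, Units.val_mul, Units.val_mul, val_nExt_TUnit hth (Nat.lt_succ_self m),
      val_nExt_TUnit hth (Nat.succ_pos m), IsUnit.unit_spec]
    exact g_g_T hq hth

theorem Y_zero : Y (n := n) q th 0 =
    g q * (List.ofFn fun i : Fin n => T th i).reverse.prod := rfl

theorem Y_succ (i : Fin n) :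
    Y q th i.succ = Ring.inverse (T th i) * Y q th i.castSucc * Ring.inverse (T th i) := rfl

theorem Y_eq_braidY (hq : q ≠ 0) (hth : th ≠ 0) (j : Fin (n + 1)) :
    Y q th j = Units.val (braidY n (nExt (TUnit hth)) (isUnit_g (n := n) hq).unit (j : ℕ)) := by
  induction j using Fin.induction with
  | zero =>
    rw [Y_zero, Fin.val_zero, braidY, Units.val_mul, IsUnit.unit_spec, ofFn_eq_map_nExt,
      prod_reverse_eq_desc]
    intro i _ hi
    rw [zero_add] at hi
    rw [nExt_of_lt _ hi, val_nExt_TUnit hth hi]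
  | succ i ih =>
    rw [Y_succ, ih, Fin.val_succ, braidY, Units.val_mul, Units.val_mul,
      show T th i = Units.val (nExt (TUnit hth) (i : ℕ)) from (val_nExt_TUnit hth i.2).symm,
      Ring.inverse_unit, Fin.val_castSucc]

theorem affineHeckeRelations (hq : q ≠ 0) (hth : th ≠ 0) :
    AffineHeckeRelations th (T (n := n) th) (Y q th) where
  quadratic := T_quadratic hth
  braid _ _ := T_braid hth
  far _ _ := T_far hth
  isUnit_Y j := by rw [Y_eq_braidY hq hth]; exact Units.isUnit _
  Y_comm j k := by
    rw [Y_eq_braidY hq hth, Y_eq_braidY hq hth]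
    exact congrArg Units.val ((isAffineBraid hq hth).commute_Y j k (by omega) (by omega)).eq
  T_Y_T i := by
    rw [Y_succ, mul_assoc, mul_assoc, mul_assoc, Ring.inverse_mul_cancel _ (isUnit_T hth i),
      mul_one, ← mul_assoc, Ring.mul_inverse_cancel _ (isUnit_T hth i), one_mul]
  T_Y i j h1 h2 := by
    rw [Y_eq_braidY hq hth,
      show T th i = Units.val (nExt (TUnit hth) (i : ℕ)) from (val_nExt_TUnit hth i.2).symm]
    simp only [ne_eq, Fin.ext_iff, Fin.val_castSucc, Fin.val_succ] at h1 h2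
    exact congrArg Units.val
      ((isAffineBraid hq hth).commute_T_Y i j i.2 (by omega) h1 h2).eq

end

/-! ### The sorting permutation and the eigenvalues -/

/-- The order in which `v_μ` sorts the positions. -/
def Prec {N : ℕ} (μ : Fin N → ℤ) (j k : Fin N) : Prop := μ j < μ k ∨ μ j = μ k ∧ j < k

/-- The minimal sorting permutation is the inverse of the stable sort, so ties are broken by
position. -/
theorem vPerm_lt_iff {N : ℕ} (μ : Fin N → ℤ) (j k : Fin N) :
    vPerm μ j < vPerm μ k ↔ Prec μ j k := by
  obtain ⟨h1, h2⟩ := (Tuple.eq_sort_iff (f := μ) (σ := (vPerm μ)⁻¹)).1 (by rw [vPerm_eq, inv_inv])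
  have key : ∀ j k, vPerm μ j < vPerm μ k → Prec μ j k := by
    intro j k hjk
    have h3 := h1 hjk.le
    simp only [Function.comp, Equiv.Perm.inv_def, Equiv.symm_apply_apply] at h3
    rcases h3.lt_or_eq with h | h
    · exact Or.inl h
    · have := h2 _ _ hjk (by simpa using h)
      simp only [Equiv.Perm.inv_def, Equiv.symm_apply_apply] at this
      exact Or.inr ⟨h, this⟩
  refine ⟨key j k, fun h => ?_⟩
  by_contra hcon
  rcases (not_lt.mp hcon).lt_or_eq with hlt | heq
  · rcases key k j hlt with h' | ⟨h', h''⟩ <;> rcases h with h3 | ⟨h3, h4⟩ <;> omega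
  · have := (vPerm μ).injective heq
    subst this
    rcases h with h3 | ⟨h3, h4⟩ <;> omega

theorem eq_vPerm {N : ℕ} {μ : Fin N → ℤ} {w : Equiv.Perm (Fin N)}
    (h : ∀ j k, w j < w k → Prec μ j k) : w = vPerm μ := by
  rw [vPerm_eq, eq_inv_iff_mul_eq_one, ← inv_eq_iff_mul_eq_one]
  refine Tuple.eq_sort_iff.2 ⟨fun j k hjk => ?_, fun j k hjk he => ?_⟩
  · rcases hjk.lt_or_eq with hlt | rfl
    · rcases h (w⁻¹ j) (w⁻¹ k) (by simpa using hlt) with h' | h'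
      · exact h'.le
      · exact h'.1.le
    · exact le_rfl
  · rcases h (w⁻¹ j) (w⁻¹ k) (by simpa using hjk) with h' | h'
    · exact absurd he h'.ne
    · exact h'.2

/-- For unequal neighbours, `s_i` changes the relative position of no two equal entries, so ties are
broken as before. -/
theorem vPerm_sAct {n : ℕ} {i : Fin n} {μ : Fin (n + 1) → ℤ} (h : μ i.castSucc ≠ μ i.succ)
    (j : Fin (n + 1)) : vPerm (sAct i μ) j = vPerm μ (Equiv.swap i.castSucc i.succ j) := by
  have : vPerm μ * Equiv.swap i.castSucc i.succ = vPerm (sAct i μ) := by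
    refine eq_vPerm fun j k hjk => ?_
    rw [Equiv.Perm.mul_apply, Equiv.Perm.mul_apply, vPerm_lt_iff] at hjk
    rcases hjk with hlt | ⟨he, hlt⟩
    · exact Or.inl hlt
    · refine Or.inr ⟨he, ?_⟩
      by_contra hcon
      have hij : i.castSucc ≠ i.succ := (Fin.castSucc_lt_succ (i := i)).ne
      simp only [Equiv.swap_apply_def] at he hlt
      split_ifs at he hlt <;> simp_all [Fin.ext_iff, Fin.lt_def] <;> omega
  rw [← this, Equiv.Perm.mul_apply]

theorem vPerm_add_const {N : ℕ} (μ : Fin N → ℤ) (c : ℤ) : vPerm (μ + fun _ => c) = vPerm μ := by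
  refine (eq_vPerm fun j k hjk => ?_).symm
  simpa [Prec] using (vPerm_lt_iff μ j k).mp hjk

theorem vPerm_succ_of_eq {n : ℕ} {i : Fin n} {μ : Fin (n + 1) → ℤ}
    (h : μ i.castSucc = μ i.succ) : (vPerm μ i.succ : ℕ) = vPerm μ i.castSucc + 1 := by
  have hlt : vPerm μ i.castSucc < vPerm μ i.succ :=
    (vPerm_lt_iff _ _ _).mpr (Or.inr ⟨h, Fin.castSucc_lt_succ⟩)
  by_contra hcon
  have h1 : (vPerm μ i.castSucc : ℕ) < vPerm μ i.succ := hlt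
  -- `l` is the position sorted immediately after `i`. Were it not `i+1`, it would lie strictly
  -- between two neighbouring positions with equal entries.
  obtain ⟨l, hl⟩ := (vPerm μ).surjective
    ⟨vPerm μ i.castSucc + 1, by have := (vPerm μ i.succ).2; omega⟩
  have h2 := (vPerm_lt_iff μ i.castSucc l).mp (by rw [hl, Fin.lt_def]; simp)
  have h3 := (vPerm_lt_iff μ l i.succ).mp (by rw [hl, Fin.lt_def]; simp; omega)
  simp only [Prec, Fin.lt_def, Fin.val_castSucc, Fin.val_succ] at h2 h3
  omega

theorem eig_sAct {n : ℕ} {q th : ℂ} {i : Fin n} {μ : Fin (n + 1) → ℤ}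
    (h : μ i.castSucc ≠ μ i.succ) (j : Fin (n + 1)) :
    eig q th (sAct i μ) j = eig q th μ (Equiv.swap i.castSucc i.succ j) := by
  rw [eig, vPerm_sAct h]; rfl

theorem eig_ne_zero {n : ℕ} {q th : ℂ} (hq : q ≠ 0) (hth : th ≠ 0) (μ : Fin (n + 1) → ℤ)
    (i : Fin (n + 1)) : eig q th μ i ≠ 0 :=
  mul_ne_zero (zpow_ne_zero _ hq) (zpow_ne_zero _ hth)

theorem eig_div_eig {n : ℕ} {q th : ℂ} (hq : q ≠ 0) (hth : th ≠ 0) (μ : Fin (n + 1) → ℤ)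
    (j k : Fin (n + 1)) : eig q th μ k / eig q th μ j = ratio q th μ j k := by
  have h2 : th ^ 2 = th ^ (2 : ℤ) := by norm_cast
  rw [eig, eig, ratio, h2, ← zpow_mul, mul_div_mul_comm, ← zpow_sub₀ hq, ← zpow_sub₀ hth]
  congr 2 <;> ring

theorem prod_range_sign {th : ℂ} (hth : th ≠ 0) (k d : ℕ) :
    ∏ m ∈ Finset.range (k + 1 + d), (if m = k then 1 else if m < k then th⁻¹ else th) =
      th ^ (-(k : ℤ) + d) := by
  have h2 : ∀ m ∈ Finset.range k, (if m = k then 1 else if m < k then th⁻¹ else th) = th⁻¹ := by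
    intro m hm
    rw [Finset.mem_range] at hm
    rw [if_neg hm.ne, if_pos hm]
  have h3 : ∀ m ∈ Finset.range d,
      (if k + 1 + m = k then 1 else if k + 1 + m < k then th⁻¹ else th) = th := by
    intro m _
    rw [if_neg (by omega), if_neg (by omega)]
  rw [Finset.prod_range_add, Finset.prod_range_succ,
    Finset.prod_congr rfl h2, Finset.prod_congr rfl h3, Finset.prod_const, Finset.prod_const,
    Finset.card_range, Finset.card_range, if_pos rfl, mul_one, inv_pow, ← zpow_natCast,
    ← zpow_natCast, ← zpow_neg, ← zpow_add₀ hth]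

theorem prod_sign {n : ℕ} {th : ℂ} (hth : th ≠ 0) (k : Fin (n + 1)) :
    ∏ m : Fin (n + 1), (if m = k then 1 else if m < k then th⁻¹ else th) =
      th ^ (-2 * ((k : ℕ) : ℤ) + n) := by
  have h1 := Fin.prod_univ_eq_prod_range
    (fun m => if m = (k : ℕ) then 1 else if m < (k : ℕ) then th⁻¹ else th) (n + 1)
  have h2 := prod_range_sign hth k (n - k)
  rw [show (k : ℕ) + 1 + (n - k) = n + 1 by omega, ← h1, Nat.cast_sub (by omega)] at h2
  simp only [Fin.ext_iff, Fin.lt_def]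
  rw [h2]
  congr 1
  ring

open Classical in
-- `v_μ(i)` counts the positions sorted before `i`, so the power of `th` splits into one factor for
-- each other position. The diagonal entries of `U` and `V` arise in this form.
theorem eig_eq_prod {n : ℕ} {q th : ℂ} (hth : th ≠ 0) (μ : Fin (n + 1) → ℤ) (i : Fin (n + 1)) :
    eig q th μ i =
      q ^ (-μ i) * ∏ l : Fin (n + 1), (if l = i then 1 else if Prec μ l i then th⁻¹ else th) := by
  rw [eig, ← prod_sign hth, ← Equiv.prod_comp (vPerm μ)]
  congr 1
  refine Finset.prod_congr rfl fun l _ => ?_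
  simp only [(vPerm μ).injective.eq_iff, vPerm_lt_iff]

/-! ### Consequences of genericity. -/

section Generic

variable {n : ℕ} {q th : ℂ}

/-- Adding a constant `c` to all entries keeps `v_μ` and multiplies every eigenvalue by `q^{-c}`, so
genericity forbids `q` to be a root of unity. -/
theorem zpow_ne_one_of_generic
    (hgen : ∀ μ ν : Fin (n + 1) → ℤ, (∀ i, eig q th μ i = eig q th ν i) → μ = ν)
    {c : ℤ} (hc : q ^ c = 1) : c = 0 := by
  have h := hgen (0 + fun _ => c) 0 fun i => by
    rw [eig, eig, vPerm_add_const]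
    simp [hc]
  have := congrFun h 0
  simpa using this

/-- For equal neighbouring entries the eigenvalues differ by the factor `t⁻¹ ≠ 1`. For unequal ones,
a coincidence would give `s_i μ` and `μ` the same tuple. -/
theorem eig_succ_ne_eig_castSucc (hq : q ≠ 0) (hth : th ≠ 0) (ht : th ^ 2 ≠ 1)
    (hgen : ∀ μ ν : Fin (n + 1) → ℤ, (∀ i, eig q th μ i = eig q th ν i) → μ = ν)
    (i : Fin n) (μ : Fin (n + 1) → ℤ) : eig q th μ i.succ ≠ eig q th μ i.castSucc := by
  intro he
  by_cases h : μ i.castSucc = μ i.succ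
  · have h1 := vPerm_succ_of_eq h
    rw [eig, eig, h] at he
    have h2 := mul_left_cancel₀ (zpow_ne_zero _ hq) he
    rw [h1, show -2 * (((vPerm μ i.castSucc : ℕ) + 1 : ℕ) : ℤ) + n =
      (-2 * ((vPerm μ i.castSucc : ℕ) : ℤ) + n) + -2 by push_cast; ring, zpow_add₀ hth] at h2
    have h3 := mul_eq_left₀ (zpow_ne_zero _ hth) |>.mp h2
    rw [zpow_neg, inv_eq_one] at h3
    exact ht (by exact_mod_cast h3)
  · have := hgen (sAct i μ) μ fun j => by
      rw [eig_sAct h]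
      by_cases h1 : j = i.castSucc
      · subst h1; rw [Equiv.swap_apply_left, he]
      · by_cases h2 : j = i.succ
        · subst h2; rw [Equiv.swap_apply_right, he]
        · rw [Equiv.swap_apply_of_ne_of_ne h1 h2]
    have := congrFun this i.succ
    rw [sAct, Function.comp, Equiv.swap_apply_right] at this
    exact h this

/-- When `μ_i = μ_{i+1}`, exchanging the two neighbouring eigenvalues of `μ` does not give the
eigenvalues of any `ν`. -/
theorem eig_swap_ne (hq : q ≠ 0) (hth : th ≠ 0) (ht : th ^ 2 ≠ 1)
    (hgen : ∀ μ ν : Fin (n + 1) → ℤ, (∀ i, eig q th μ i = eig q th ν i) → μ = ν)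
    {i : Fin n} {μ : Fin (n + 1) → ℤ} (h : μ i.castSucc = μ i.succ) (ν : Fin (n + 1) → ℤ) :
    ¬ ∀ j, eig q th ν j = eig q th μ (Equiv.swap i.castSucc i.succ j) := by
  intro he
  by_cases hν : ν i.castSucc = ν i.succ
  · have h1 := he i.castSucc
    have h2 := he i.succ
    rw [Equiv.swap_apply_left] at h1
    rw [Equiv.swap_apply_right] at h2
    have e1 : ratio q th μ i.castSucc i.succ = (th ^ 2) ^ (-1 : ℤ) := by
      rw [ratio, h, vPerm_succ_of_eq h]; simp
    have e2 : ratio q th ν i.castSucc i.succ = (th ^ 2) ^ (-1 : ℤ) := by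
      rw [ratio, hν, vPerm_succ_of_eq hν]; simp
    rw [← eig_div_eig hq hth] at e1 e2
    rw [h1, h2, ← inv_div, e1] at e2
    -- Both neighbouring ratios are `t⁻¹`, yet the exchange inverts the ratio, so `t ^ 2 = 1`. Then
    -- squared eigenvalues no longer see `v`, only powers of `q`, which forces `ν = μ`.
    have ht4 : th ^ 4 = 1 := by
      have ht0 := pow_ne_zero 2 hth
      simp only [zpow_neg, zpow_one, inv_inv] at e2
      field_simp at e2
      linear_combination e2
    have hpow : ∀ m : ℤ, (th ^ m) ^ 2 = (th ^ (2 * m)) := fun m => by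
      rw [← zpow_natCast, ← zpow_mul]; congr 1; push_cast; ring
    have h4 : ∀ m : ℤ, th ^ (4 * m) = 1 := fun m => by
      rw [zpow_mul, show th ^ (4 : ℤ) = th ^ 4 by norm_cast, ht4, one_zpow]
    have hsq : ∀ (κ : Fin (n + 1) → ℤ) j, eig q th κ j ^ 2 = q ^ (-2 * κ j) * th ^ (2 * (n : ℤ)) := by
      intro κ j
      rw [eig, mul_pow, hpow, show 2 * (-2 * ((vPerm κ j : ℕ) : ℤ) + n) =
        4 * (-((vPerm κ j : ℕ) : ℤ)) + 2 * n by ring, zpow_add₀ hth, h4, one_mul,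
        ← zpow_natCast, ← zpow_mul]
      congr 2
      push_cast
      ring
    have hμν : ν = μ := by
      funext j
      have h5 := congrArg (· ^ 2) (he j)
      simp only [hsq] at h5
      have h6 := mul_right_cancel₀ (zpow_ne_zero _ hth) h5
      have h7 : μ (Equiv.swap i.castSucc i.succ j) = μ j := by
        rw [Equiv.swap_apply_def]; split_ifs with g1 g2
        · rw [g1, h]
        · rw [g2, h]
        · rfl
      rw [h7] at h6
      have h8 : q ^ (-2 * ν j - -2 * μ j) = 1 := by
        rw [zpow_sub₀ hq, h6, div_self (zpow_ne_zero _ hq)]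
      have := zpow_ne_one_of_generic hgen h8
      omega
    rw [hμν] at h1
    exact eig_succ_ne_eig_castSucc hq hth ht hgen i μ h1.symm
  · have := hgen (sAct i ν) μ fun j => by rw [eig_sAct hν, he, Equiv.swap_apply_self]
    rw [← this] at h
    apply hν
    simpa [sAct] using h.symm

end Generic

/-! ### Triangularity -/

section Order

variable {N : ℕ}

/-- The square of the Euclidean norm. -/
def sqNorm (μ : Fin N → ℤ) : ℤ := ∑ j, μ j ^ 2

/-- The linear form with coefficients `c`. -/
def wt (c μ : Fin N → ℤ) : ℤ := ∑ j, c j * μ j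

/-- Lexicographic comparison by `sqNorm` and then by `wt c`. -/
def Lower (c ν μ : Fin N → ℤ) : Prop :=
  sqNorm ν < sqNorm μ ∨ sqNorm ν = sqNorm μ ∧ wt c ν < wt c μ

theorem Lower.trans {c κ ν μ : Fin N → ℤ} (h : Lower c κ ν) (h' : Lower c ν μ) : Lower c κ μ := by
  unfold Lower at *; omega

theorem Lower.irrefl (c μ : Fin N → ℤ) : ¬ Lower c μ μ := by
  unfold Lower; omega

theorem sqNorm_comp (μ : Fin N → ℤ) (π : Equiv.Perm (Fin N)) : sqNorm (μ ∘ π) = sqNorm μ :=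
  Equiv.sum_comp π fun j => μ j ^ 2

theorem wt_comp (c μ : Fin N → ℤ) (π : Equiv.Perm (Fin N)) : wt (c ∘ π) (μ ∘ π) = wt c μ :=
  Equiv.sum_comp π fun j => c j * μ j

theorem lower_comp {c ν μ : Fin N → ℤ} (π : Equiv.Perm (Fin N)) :
    Lower (c ∘ π) (ν ∘ π) (μ ∘ π) ↔ Lower c ν μ := by
  simp only [Lower, sqNorm_comp, wt_comp]

/-- The span of the monomials below `μ`. -/
noncomputable def Low (c μ : Fin N → ℤ) : Submodule ℂ (Laurent N) := Submodule.span ℂ (mon '' {ν | Lower c ν μ})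

theorem mon_mem_Low {c ν μ : Fin N → ℤ} (h : Lower c ν μ) : mon ν ∈ Low c μ :=
  Submodule.subset_span ⟨ν, h, rfl⟩

theorem Low_mono {c ν μ : Fin N → ℤ} (h : Lower c ν μ) : Low c ν ≤ Low c μ :=
  Submodule.span_mono (Set.image_mono fun _ h' => Lower.trans h' h)

theorem coeff_mon (μ ν : Fin N → ℤ) : (mon μ).coeff ν = if μ = ν then 1 else 0 := by
  simp [mon, Finsupp.single_apply]

theorem coeff_eq_zero_of_mem_Low {c ν μ : Fin N → ℤ} {f : Laurent N} (hf : f ∈ Low c μ)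
    (h : ¬ Lower c ν μ) : f.coeff ν = 0 := by
  induction hf using Submodule.span_induction with
  | mem x hx =>
    obtain ⟨κ, hκ, rfl⟩ := hx
    rw [coeff_mon, if_neg]
    rintro rfl
    exact h hκ
  | zero => simp
  | add x y _ _ hx hy => simp [hx, hy]
  | smul a x _ hx => simp [hx]

/-- `A` maps `x^μ` to `d μ x^{μ ∘ π}` plus lower terms, where the order is also permuted by `π`. -/
def Tri (c : Fin N → ℤ) (π : Equiv.Perm (Fin N)) (d : (Fin N → ℤ) → ℂ)
    (A : Module.End ℂ (Laurent N)) : Prop :=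
  ∀ μ, A (mon μ) - d μ • mon (μ ∘ π) ∈ Low (c ∘ π) (μ ∘ π)

theorem Tri.apply_mem_Low {c : Fin N → ℤ} {π : Equiv.Perm (Fin N)} {d : (Fin N → ℤ) → ℂ}
    {A : Module.End ℂ (Laurent N)} (h : Tri c π d A) {μ : Fin N → ℤ} {f : Laurent N}
    (hf : f ∈ Low c μ) : A f ∈ Low (c ∘ π) (μ ∘ π) := by
  induction hf using Submodule.span_induction with
  | mem x hx =>
    obtain ⟨ν, hν, rfl⟩ := hx
    have h1 := Low_mono ((lower_comp π).mpr hν) (h ν)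
    have h2 := Submodule.smul_mem _ (d ν) (mon_mem_Low ((lower_comp π).mpr hν))
    simpa using Submodule.add_mem _ h1 h2
  | zero => simp
  | add x y _ _ hx hy => rw [map_add]; exact Submodule.add_mem _ hx hy
  | smul a x _ hx => rw [map_smul]; exact Submodule.smul_mem _ a hx

/-- Orders compose along with permutations: `B` has to be triangular starting from the order in
which `A` ends. A product can thus be triangular for a fixed order although its factors are not. -/
theorem Tri.mul {c : Fin N → ℤ} {π π' : Equiv.Perm (Fin N)} {d d' : (Fin N → ℤ) → ℂ}
    {A B : Module.End ℂ (Laurent N)} (hB : Tri (c ∘ π) π' d' B) (hA : Tri c π d A) :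
    Tri c (π * π') (fun μ => d μ * d' (μ ∘ π)) (B * A) := by
  intro μ
  have h1 := hB.apply_mem_Low (hA μ)
  have h2 := Submodule.smul_mem _ (d μ) (hB (μ ∘ π))
  have h3 := Submodule.add_mem _ h1 h2
  rw [map_sub, map_smul, smul_sub, sub_add_sub_cancel, smul_smul] at h3
  exact h3

theorem Tri.congr {c : Fin N → ℤ} {π π' : Equiv.Perm (Fin N)} {d d' : (Fin N → ℤ) → ℂ}
    {A : Module.End ℂ (Laurent N)} (hA : Tri c π d A) (hπ : π = π') (hd : ∀ μ, d μ = d' μ) :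
    Tri c π' d' A := by
  obtain rfl := funext hd
  exact hπ ▸ hA

/-- The span of the monomials of norm less than that of `μ`. -/
noncomputable def NormLow (μ : Fin N → ℤ) : Submodule ℂ (Laurent N) :=
  Submodule.span ℂ (mon '' {ν | sqNorm ν < sqNorm μ})

theorem NormLow_le_Low (c : Fin N → ℤ) {ν μ : Fin N → ℤ} (h : sqNorm ν = sqNorm μ) :
    NormLow ν ≤ Low c μ :=
  Submodule.span_mono (Set.image_mono fun _ h' => Or.inl (h ▸ h'))

end Order

/-! ### Triangularity of the `T_i`, their inverses and the `Y_j`. -/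

section TriT

variable {n : ℕ} {q th : ℂ}

/-- With `d` the difference of the two entries, moving `j` units lowers the squared norm by `2j(d -
j)`. -/
theorem sqNorm_string_lt (i : Fin n) (ν : Fin (n + 1) → ℤ) (j : ℤ) (h0 : 0 < j)
    (h1 : j < ν i.castSucc - ν i.succ) :
    sqNorm (ν - j • Pi.single i.castSucc 1 + j • Pi.single i.succ 1) < sqNorm ν := by
  have hne : i.castSucc ≠ i.succ := (Fin.castSucc_lt_succ (i := i)).ne
  rw [← sub_neg, sqNorm, sqNorm, ← Finset.sum_sub_distrib,
    Fintype.sum_eq_add i.castSucc i.succ hne]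
  · simp [hne, hne.symm]
    nlinarith
  · intro l hl
    simp [hl.1, hl.2]

/-- The product is the sum of `t • m j - m (j+1)` along the string from `ν` to `s_i ν`. The two ends
give the stated terms and every interior monomial has smaller norm. -/
theorem mul_string_sum_mem (t : ℂ) (i : Fin n) (ν : Fin (n + 1) → ℤ) (h : ν i.succ < ν i.castSucc) :
    (t • X i.castSucc - X i.succ) * (∑ j ∈ Finset.range (ν i.castSucc - ν i.succ).toNat,
      mon (ν - ((j : ℤ) + 1) • Pi.single i.castSucc 1 + (j : ℤ) • Pi.single i.succ 1)) -
      (t • mon ν - mon (sAct i ν)) ∈ NormLow ν := by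
  obtain ⟨k, hk⟩ : ∃ k : ℕ, ν i.castSucc - ν i.succ = k + 1 :=
    ⟨(ν i.castSucc - ν i.succ - 1).toNat, by omega⟩
  let m : ℕ → Laurent (n + 1) := fun j =>
    mon (ν - (j : ℤ) • Pi.single i.castSucc 1 + (j : ℤ) • Pi.single i.succ 1)
  have hm : ∀ j ∈ Finset.range (k + 1), (t • X i.castSucc - X i.succ) *
      mon (ν - ((j : ℤ) + 1) • Pi.single i.castSucc 1 + (j : ℤ) • Pi.single i.succ 1) =
      t • m j - m (j + 1) := by
    intro j _
    rw [sub_mul, smul_mul_assoc, X, X, mon_mul_mon, mon_mul_mon]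
    congr 2
    · congr 1
      rw [add_smul, one_smul]; abel
    · push_cast; rw [add_smul, add_smul, one_smul, one_smul]; abel
  have h0 : m 0 = mon ν := by simp [m]
  have hlast : m (k + 1) = mon (sAct i ν) := by
    rw [← shift_eq_sAct, hk]; simp [m]
  rw [hk, show ((k : ℤ) + 1).toNat = k + 1 by omega, Finset.mul_sum, Finset.sum_congr rfl hm,
    Finset.sum_sub_distrib, Finset.sum_range_succ', Finset.sum_range_succ (fun j => m (j + 1)),
    h0, hlast, show ∀ a b c d : Laurent (n + 1), a + b - (c + d) - (b - d) = a - c by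
      intros; abel]
  have hmem : ∀ j ∈ Finset.range k, m (j + 1) ∈ NormLow ν := by
    intro j hj
    rw [Finset.mem_range] at hj
    refine Submodule.subset_span ⟨_, sqNorm_string_lt i ν _ ?_ ?_, rfl⟩
    · push_cast; omega
    · push_cast; omega
  exact Submodule.sub_mem _
    (Submodule.sum_mem _ fun j hj => Submodule.smul_mem _ _ (hmem j hj))
    (Submodule.sum_mem _ hmem)

theorem T_mon_of_gt {i : Fin n} {μ : Fin (n + 1) → ℤ}
    (h : μ i.succ < μ i.castSucc) :
    T th i (mon μ) - th⁻¹ • mon (sAct i μ) ∈ NormLow μ := by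
  have h1 := Submodule.smul_mem _ (-th⁻¹) (mul_string_sum_mem (th ^ 2) i μ h)
  convert h1 using 1
  rw [T, LinearMap.smul_apply, LinearMap.sub_apply, LinearMap.comp_apply, divDiff, monLin_mon,
    show (μ i.succ - μ i.castSucc).toNat = 0 by omega, Finset.sum_range_zero, sub_zero]
  simp only [LinearMap.smul_apply, Module.End.one_apply, LinearMap.mulLeft_apply]
  module

/-- Unlike in the case `μ_i > μ_{i+1}`, two monomials of maximal norm survive. The multiple of `x^μ`
is exactly what passing to `T_i⁻¹ = T_i - (th - th⁻¹)` removes here, and what it introduces in the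
other case. -/
theorem T_mon_of_lt (hth : th ≠ 0) {i : Fin n} {μ : Fin (n + 1) → ℤ}
    (h : μ i.castSucc < μ i.succ) :
    T th i (mon μ) - th • mon (sAct i μ) - (th - th⁻¹) • mon μ ∈ NormLow μ := by
  have h0 := mul_string_sum_mem (th ^ 2) i (sAct i μ) (by simpa [sAct] using h)
  have h1 := Submodule.smul_mem _ th⁻¹ h0
  have e : NormLow (sAct i μ) = NormLow μ := by
    simp only [NormLow]; rw [sAct, sqNorm_comp]
  rw [e, sAct_sAct] at h1
  convert h1 using 1
  rw [T, LinearMap.smul_apply, LinearMap.sub_apply, LinearMap.comp_apply, divDiff, monLin_mon,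
    show (μ i.castSucc - μ i.succ).toNat = 0 by omega, Finset.sum_range_zero, zero_sub]
  simp only [LinearMap.smul_apply, Module.End.one_apply, LinearMap.mulLeft_apply, map_neg]
  have e1 : sAct i μ i.castSucc = μ i.succ := by simp [sAct]
  have e2 : sAct i μ i.succ = μ i.castSucc := by simp [sAct]
  rw [e1, e2]
  match_scalars <;> field_simp
  ring

theorem sAct_of_eq {i : Fin n} {μ : Fin (n + 1) → ℤ} (h : μ i.castSucc = μ i.succ) :
    sAct i μ = μ := by
  rw [← shift_eq_sAct, h]; simp

theorem T_mon_of_eq (hth : th ≠ 0) {i : Fin n} {μ : Fin (n + 1) → ℤ}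
    (h : μ i.castSucc = μ i.succ) : T th i (mon μ) = th • mon (sAct i μ) := by
  rw [sAct_of_eq h, T, LinearMap.smul_apply, LinearMap.sub_apply, LinearMap.comp_apply, divDiff,
    monLin_mon, h]
  simp only [sub_self, Int.toNat_zero, Finset.sum_range_zero, map_zero, sub_zero,
    LinearMap.smul_apply, Module.End.one_apply, smul_smul]
  congr 1
  field_simp

theorem wt_sub_wt_sAct (c : Fin (n + 1) → ℤ) (i : Fin n) (μ : Fin (n + 1) → ℤ) :
    wt c μ - wt c (sAct i μ) = (c i.succ - c i.castSucc) * (μ i.succ - μ i.castSucc) := by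
  have hne : i.castSucc ≠ i.succ := (Fin.castSucc_lt_succ (i := i)).ne
  rw [wt, wt, ← Finset.sum_sub_distrib, Fintype.sum_eq_add i.castSucc i.succ hne]
  · simp [sAct]; ring
  · intro l hl
    simp [sAct, Equiv.swap_apply_of_ne_of_ne hl.1 hl.2]

theorem lower_self_sAct {c : Fin (n + 1) → ℤ} {i : Fin n} {μ : Fin (n + 1) → ℤ}
    (h : 0 < (c i.succ - c i.castSucc) * (μ i.succ - μ i.castSucc)) :
    Lower (c ∘ Equiv.swap i.castSucc i.succ) μ (sAct i μ) := by
  have h1 : Lower c (sAct i μ) μ := by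
    refine Or.inr ⟨sqNorm_comp _ _, ?_⟩
    rw [← wt_sub_wt_sAct] at h
    omega
  rw [← lower_comp (Equiv.swap i.castSucc i.succ)] at h1
  have e : sAct i μ ∘ Equiv.swap i.castSucc i.succ = μ := sAct_sAct i μ
  rw [e] at h1
  exact h1

theorem tri_sOp (c : Fin (n + 1) → ℤ) (i : Fin n) :
    Tri c (Equiv.swap i.castSucc i.succ) (fun _ => 1) (sOp i) := by
  intro μ
  rw [sOp_mon, one_smul, sAct, sub_self]
  exact Submodule.zero_mem _

/-- The norm alone decides except for the term `x^μ` when `μ_i < μ_{i+1}`; the condition on `c` puts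
it below `x^{s_i μ}` in the permuted order. For the inverse the extra term sits in the opposite
case, hence the opposite condition there. -/
theorem tri_T (hth : th ≠ 0) {c : Fin (n + 1) → ℤ} {i : Fin n} (hc : c i.castSucc < c i.succ) :
    Tri c (Equiv.swap i.castSucc i.succ)
      (fun μ => if μ i.succ < μ i.castSucc then th⁻¹ else th) (T th i) := by
  intro μ
  change T th i (mon μ) - (ite _ _ _ : ℂ) • mon (sAct i μ) ∈ Low _ (sAct i μ)
  have hle := NormLow_le_Low (c ∘ Equiv.swap i.castSucc i.succ)
    (sqNorm_comp μ (Equiv.swap i.castSucc i.succ)).symm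
  rcases lt_trichotomy (μ i.castSucc) (μ i.succ) with h | h | h
  · rw [if_neg h.not_gt]
    have h1 := hle (T_mon_of_lt hth h)
    have h2 : mon μ ∈ Low (c ∘ Equiv.swap i.castSucc i.succ) (sAct i μ) :=
      mon_mem_Low (lower_self_sAct (mul_pos (by omega) (by omega)))
    have h3 := Submodule.add_mem _ h1 (Submodule.smul_mem _ (th - th⁻¹) h2)
    rwa [sub_add_cancel] at h3
  · rw [if_neg h.not_gt, T_mon_of_eq hth h, sub_self]
    exact Submodule.zero_mem _
  · rw [if_pos h]
    exact hle (T_mon_of_gt h)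

theorem tri_inverse_T (hth : th ≠ 0) {c : Fin (n + 1) → ℤ} {i : Fin n}
    (hc : c i.succ < c i.castSucc) :
    Tri c (Equiv.swap i.castSucc i.succ)
      (fun μ => if μ i.castSucc < μ i.succ then th else th⁻¹) (Ring.inverse (T th i)) := by
  intro μ
  rw [inverse_T hth, LinearMap.sub_apply, LinearMap.smul_apply, Module.End.one_apply]
  change T th i (mon μ) - (th - th⁻¹) • mon μ - (ite _ _ _ : ℂ) • mon (sAct i μ) ∈ Low _ (sAct i μ)
  have hle := NormLow_le_Low (c ∘ Equiv.swap i.castSucc i.succ)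
    (sqNorm_comp μ (Equiv.swap i.castSucc i.succ)).symm
  rcases lt_trichotomy (μ i.castSucc) (μ i.succ) with h | h | h
  · rw [if_pos h, sub_right_comm]
    exact hle (T_mon_of_lt hth h)
  · rw [if_neg h.not_lt, T_mon_of_eq hth h, sAct_of_eq h]
    convert Submodule.zero_mem _ using 1
    module
  · rw [if_neg h.not_gt, sub_right_comm]
    have h1 := hle (T_mon_of_gt (th := th) h)
    have h2 : mon μ ∈ Low (c ∘ Equiv.swap i.castSucc i.succ) (sAct i μ) :=
      mon_mem_Low (lower_self_sAct (mul_pos_of_neg_of_neg (by omega) (by omega)))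
    exact Submodule.sub_mem _ h1 (Submodule.smul_mem _ (th - th⁻¹) h2)

/-- The left factor in `Y_i = V_i U_i`. -/
noncomputable def V (th : ℂ) : Fin (n + 1) → Module.End ℂ (Laurent (n + 1)) :=
  Fin.induction 1 fun i Vi => Ring.inverse (T th i) * Vi * sOp i

/-- The right factor in `Y_i = V_i U_i`. -/
noncomputable def U (q th : ℂ) : Fin (n + 1) → Module.End ℂ (Laurent (n + 1)) :=
  Fin.reverseInduction (qShift q) fun i Ui => sOp i * Ui * T th i

theorem V_zero : V (n := n) th 0 = 1 := rfl

theorem V_succ (i : Fin n) : V th i.succ = Ring.inverse (T th i) * V th i.castSucc * sOp i := rfl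

theorem U_last : U (n := n) q th (Fin.last n) = qShift q := Fin.reverseInduction_last ..

theorem U_castSucc (i : Fin n) : U q th i.castSucc = sOp i * U q th i.succ * T th i :=
  Fin.reverseInduction_castSucc ..

theorem U_eq_prod (m k : ℕ) (h : k + m = n) :
    U q th (⟨k, by omega⟩ : Fin (n + 1)) =
      ((List.range' k m).map (nExt fun i : Fin n => sOp i)).prod * qShift q *
        ((List.range' k m).map (nExt fun i : Fin n => T th i)).reverse.prod := by
  induction m generalizing k with
  | zero =>
    have e : (⟨k, by omega⟩ : Fin (n + 1)) = Fin.last n := Fin.ext (by simpa using h)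
    rw [e, U_last]
    simp
  | succ m ih =>
    have hk : k < n := by omega
    have e := U_castSucc (q := q) (th := th) (⟨k, hk⟩ : Fin n)
    simp only [Fin.castSucc_mk, Fin.succ_mk] at e
    rw [e, ih (k + 1) (by omega), List.range'_succ]
    simp only [List.map_cons, List.prod_cons, List.reverse_cons, List.prod_append, List.prod_nil,
      mul_one, nExt_of_lt _ hk, mul_assoc]

/-- In usual numbering, `U_i = s_i ⋯ s_n T_{q⁻¹} T_n ⋯ T_i` and `V_i = T_{i-1}⁻¹ ⋯ T_1⁻¹ s_1 ⋯
s_{i-1}`. Each `T` or `T⁻¹` is paired with its own reflection, so both factors preserve the order.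
Only positive powers of `T` occur in `U` and only inverses in `V`. -/
theorem Y_eq_V_mul_U (hth : th ≠ 0) (j : Fin (n + 1)) : Y q th j = V th j * U q th j := by
  induction j using Fin.induction with
  | zero =>
    rw [V_zero, one_mul, Y_zero, g]
    have := U_eq_prod (q := q) (th := th) n 0 (Nat.zero_add n)
    rw [ofFn_eq_map_nExt, ofFn_eq_map_nExt]
    exact this.symm
  | succ i ih =>
    rw [Y_succ, ih, V_succ, U_castSucc]
    simp only [mul_assoc]
    rw [Ring.mul_inverse_cancel _ (isUnit_T hth i), mul_one]

/-- The reflections move position `j` to the front and the inverses bring it back, each comparing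
its entry with that of one `l < j`. The hypothesis on `c` is what `tri_inverse_T` needs at these
comparisons. -/
theorem tri_V (hth : th ≠ 0) (j : Fin (n + 1)) (c : Fin (n + 1) → ℤ) (hc : ∀ l < j, c l < c j) :
    Tri c 1 (fun μ => ∏ l ∈ Finset.Iio j, if μ j < μ l then th else th⁻¹) (V th j) := by
  induction j using Fin.induction generalizing c with
  | zero =>
    intro μ
    have : Finset.Iio (0 : Fin (n + 1)) = ∅ := by ext; simp
    simp [V_zero, this]
  | succ i ih =>
    have hsw : ∀ l < i.castSucc, Equiv.swap i.castSucc i.succ l = l := fun l hl =>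
      Equiv.swap_apply_of_ne_of_ne hl.ne (hl.trans Fin.castSucc_lt_succ).ne
    have h1 := tri_sOp c i
    have h2 := ih (c ∘ Equiv.swap i.castSucc i.succ) fun l hl => by
      simp only [Function.comp, hsw l hl, Equiv.swap_apply_left]
      exact hc l (hl.trans Fin.castSucc_lt_succ)
    have h3 := tri_inverse_T hth (c := c ∘ Equiv.swap i.castSucc i.succ) (i := i) (by
      simp only [Function.comp, Equiv.swap_apply_left, Equiv.swap_apply_right]
      exact hc _ Fin.castSucc_lt_succ)
    rw [V_succ, mul_assoc]
    have h4 : Tri c (Equiv.swap i.castSucc i.succ * 1) _ (V th i.castSucc * sOp i) := h2.mul h1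
    have h5 : Tri c (Equiv.swap i.castSucc i.succ * 1 * Equiv.swap i.castSucc i.succ) _
      (Ring.inverse (T th i) * (V th i.castSucc * sOp i)) := Tri.mul h3 h4
    refine h5.congr (by simp) fun μ => ?_
    have hI : Finset.Iio i.succ = insert i.castSucc (Finset.Iio i.castSucc) := by
      ext l
      simp only [Finset.mem_Iio, Finset.mem_insert, Fin.lt_def, Fin.ext_iff, Fin.val_succ,
        Fin.val_castSucc]
      omega
    rw [hI, Finset.prod_insert (by simp), one_mul, mul_comm]
    congr 1
    · simp
    · refine Finset.prod_congr rfl fun l hl => ?_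
      simp only [Function.comp, hsw l (Finset.mem_Iio.mp hl), Equiv.swap_apply_left]

theorem tri_U (hth : th ≠ 0) (j : Fin (n + 1)) (c : Fin (n + 1) → ℤ) (hc : ∀ l, j < l → c j < c l) :
    Tri c 1 (fun μ => q ^ (-μ j) * ∏ l ∈ Finset.Ioi j, if μ l < μ j then th⁻¹ else th)
      (U q th j) := by
  induction j using Fin.reverseInduction generalizing c with
  | last =>
    intro μ
    have : Finset.Ioi (Fin.last n) = ∅ := by ext l; simp [Fin.le_last]
    simp [U_last, this, qShift, monLin_mon]
  | cast i ih =>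
    have hsw : ∀ l, i.succ < l → Equiv.swap i.castSucc i.succ l = l := fun l hl =>
      Equiv.swap_apply_of_ne_of_ne (Fin.castSucc_lt_succ.trans hl).ne' hl.ne'
    have h1 := tri_T hth (hc _ Fin.castSucc_lt_succ)
    have h2 := ih (c ∘ Equiv.swap i.castSucc i.succ) fun l hl => by
      simp only [Function.comp, hsw l hl, Equiv.swap_apply_right]
      exact hc l (Fin.castSucc_lt_succ.trans hl)
    have h3 := tri_sOp (c ∘ Equiv.swap i.castSucc i.succ) i
    rw [U_castSucc, mul_assoc]
    have h4 : Tri c (Equiv.swap i.castSucc i.succ * 1) _ (U q th i.succ * T th i) := h2.mul h1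
    have h5 : Tri c (Equiv.swap i.castSucc i.succ * 1 * Equiv.swap i.castSucc i.succ) _
      (sOp i * (U q th i.succ * T th i)) := Tri.mul h3 h4
    refine h5.congr (by simp) fun μ => ?_
    have hI : Finset.Ioi i.castSucc = insert i.succ (Finset.Ioi i.succ) := by
      ext l
      simp only [Finset.mem_Ioi, Finset.mem_insert, Fin.lt_def, Fin.ext_iff, Fin.val_succ,
        Fin.val_castSucc]
      omega
    rw [hI, Finset.prod_insert (by simp), mul_one, mul_left_comm]
    congr 1
    · simp
    · congr 1
      refine Finset.prod_congr rfl fun l hl => ?_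
      simp only [Function.comp, hsw l (Finset.mem_Ioi.mp hl), Equiv.swap_apply_right]

/-- The order on `ℤ^{n+1}` for which the `Y_i` are triangular. -/
def baseWt (n : ℕ) : Fin (n + 1) → ℤ := fun j => (j : ℕ)

/-- Increasing weights meet the conditions of `tri_U` and `tri_V` for all `j` at once. `U`
contributes the factors of `eig_eq_prod` with `l > j`, and `V` those with `l < j`. -/
theorem Y_mon_sub_mem (hth : th ≠ 0) (j : Fin (n + 1)) (μ : Fin (n + 1) → ℤ) :
    Y q th j (mon μ) - eig q th μ j • mon μ ∈ Low (baseWt n) μ := by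
  classical
  have h1 := tri_U (q := q) hth j (baseWt n) fun l hl => by simpa [baseWt] using hl
  have h2 := tri_V hth j (baseWt n) fun l hl => by simpa [baseWt] using hl
  have h3 : Tri (baseWt n) (1 * 1) _ (V th j * U q th j) := Tri.mul h2 h1
  rw [← Y_eq_V_mul_U hth] at h3
  have h4 := h3.congr (one_mul 1) (d' := fun μ => eig q th μ j) fun μ => ?_
  · exact h4 μ
  · change _ * (∏ l ∈ Finset.Iio j, if μ j < μ l then th else th⁻¹) = _
    rw [eig_eq_prod hth, mul_assoc]
    congr 1
    rw [← Finset.mul_prod_erase Finset.univ _ (Finset.mem_univ j), if_pos rfl, one_mul]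
    have hd : Finset.univ.erase j = Finset.Ioi j ∪ Finset.Iio j := by
      ext l
      simp only [Finset.mem_erase, Finset.mem_univ, and_true, Finset.mem_union, Finset.mem_Ioi,
        Finset.mem_Iio]
      exact ne_comm.trans lt_or_lt_iff_ne.symm
    rw [hd, Finset.prod_union]
    · congr 1
      · refine Finset.prod_congr rfl fun l hl => ?_
        have hl' := Finset.mem_Ioi.mp hl
        rw [if_neg hl'.ne']
        have : Prec μ l j ↔ μ l < μ j := by simp [Prec, hl'.not_gt]
        simp only [this]
      · refine Finset.prod_congr rfl fun l hl => ?_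
        have hl' := Finset.mem_Iio.mp hl
        rw [if_neg hl'.ne]
        have : Prec μ l j ↔ ¬ μ j < μ l := by simp only [Prec, hl', and_true]; omega
        simp only [this, ite_not]
    · rw [Finset.disjoint_left]
      intro l h5 h6
      exact lt_asymm (Finset.mem_Ioi.mp h5) (Finset.mem_Iio.mp h6)

end TriT

/-! ### The nonsymmetric Macdonald polynomials -/

section Eigenbasis

variable {n : ℕ} {q th : ℂ}

theorem finite_lower {N : ℕ} (c μ : Fin N → ℤ) : {ν | Lower c ν μ}.Finite := by
  refine (Set.finite_Icc (fun _ => -sqNorm μ) (fun _ => sqNorm μ)).subset fun ν hν => ?_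
  have h1 : sqNorm ν ≤ sqNorm μ := by
    rcases hν with h | h
    · exact h.le
    · exact h.1.le
  have h2 : ∀ j, ν j ^ 2 ≤ sqNorm μ := fun j =>
    (Finset.single_le_sum (fun l _ => sq_nonneg (ν l)) (Finset.mem_univ j)).trans h1
  refine ⟨fun j => ?_, fun j => ?_⟩
  · have := Int.le_self_sq (-ν j)
    have := h2 j
    change -sqNorm μ ≤ ν j
    rw [neg_sq] at *
    linarith
  · have := Int.le_self_sq (ν j)
    have := h2 j
    change ν j ≤ sqNorm μ
    linarith

theorem lower_induction {N : ℕ} (c : Fin N → ℤ) {P : (Fin N → ℤ) → Prop}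
    (h : ∀ μ, (∀ ν, Lower c ν μ → P ν) → P μ) (μ : Fin N → ℤ) : P μ := by
  have wf : WellFounded (Lower c) := by
    -- The number of lower exponents, finite by the norm bound, strictly decreases.
    refine Subrelation.wf ?_ (measure fun μ => {ν | Lower c ν μ}.ncard).wf
    intro ν μ hνμ
    refine Set.ncard_lt_ncard ⟨fun κ hκ => Lower.trans hκ hνμ, fun hsub => ?_⟩ (finite_lower c μ)
    exact Lower.irrefl c ν (hsub hνμ)
  exact wf.induction μ h

theorem coeff_eq_one {c μ : Fin (n + 1) → ℤ} {f : Laurent (n + 1)} (hf : f - mon μ ∈ Low c μ) :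
    f.coeff μ = 1 := by
  have h := coeff_eq_zero_of_mem_Low hf (Lower.irrefl c μ)
  rw [AddMonoidAlgebra.coeff_sub, Finsupp.sub_apply, coeff_mon, if_pos rfl, sub_eq_zero] at h
  exact h

/-- The operator `Y_{J ν} - eig ν (J ν)`. -/
noncomputable def shiftY (q th : ℂ) (J : (Fin (n + 1) → ℤ) → Fin (n + 1))
    (ν : Fin (n + 1) → ℤ) : Module.End ℂ (Laurent (n + 1)) :=
  Y q th (J ν) - eig q th ν (J ν) • 1

theorem commute_Y_shiftY (hq : q ≠ 0) (hth : th ≠ 0) (J : (Fin (n + 1) → ℤ) → Fin (n + 1))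
    (ν : Fin (n + 1) → ℤ) (i : Fin (n + 1)) : Commute (Y q th i) (shiftY q th J ν) :=
  Commute.sub_right ((affineHeckeRelations hq hth).Y_comm i (J ν))
    ((Commute.one_right _).smul_right _)

theorem pairwise_commute_shiftY (hq : q ≠ 0) (hth : th ≠ 0)
    (J : (Fin (n + 1) → ℤ) → Fin (n + 1)) (S : Set (Fin (n + 1) → ℤ)) :
    S.Pairwise (Function.onFun Commute (shiftY q th J)) := fun ν _ κ _ _ =>
  (commute_Y_shiftY hq hth J κ (J ν)).sub_left ((Commute.one_left _).smul_left _)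

/-- The product of the operators `shiftY` over a finite set. -/
noncomputable def prodShiftY (hq : q ≠ 0) (hth : th ≠ 0) (J : (Fin (n + 1) → ℤ) → Fin (n + 1))
    (S : Finset (Fin (n + 1) → ℤ)) : Module.End ℂ (Laurent (n + 1)) :=
  S.noncommProd (shiftY q th J) (pairwise_commute_shiftY hq hth J S)

theorem shiftY_mon_sub_mem (hth : th ≠ 0) (J : (Fin (n + 1) → ℤ) → Fin (n + 1))
    (ν μ : Fin (n + 1) → ℤ) :
    shiftY q th J ν (mon μ) - (eig q th μ (J ν) - eig q th ν (J ν)) • mon μ ∈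
      Low (baseWt n) μ := by
  convert Y_mon_sub_mem (q := q) hth (J ν) μ using 1
  rw [shiftY, LinearMap.sub_apply, LinearMap.smul_apply, Module.End.one_apply]
  module

theorem shiftY_tri (hth : th ≠ 0) (J : (Fin (n + 1) → ℤ) → Fin (n + 1)) (ν : Fin (n + 1) → ℤ) :
    Tri (baseWt n) 1 (fun μ => eig q th μ (J ν) - eig q th ν (J ν)) (shiftY q th J ν) :=
  fun μ => shiftY_mon_sub_mem hth J ν μ

theorem prodShiftY_tri (hq : q ≠ 0) (hth : th ≠ 0) (J : (Fin (n + 1) → ℤ) → Fin (n + 1))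
    (S : Finset (Fin (n + 1) → ℤ)) :
    Tri (baseWt n) 1 (fun μ => ∏ ν ∈ S, (eig q th μ (J ν) - eig q th ν (J ν)))
      (prodShiftY hq hth J S) := by
  classical
  induction S using Finset.induction_on with
  | empty =>
    intro μ
    simp [prodShiftY]
  | insert ν S hν ih =>
    rw [prodShiftY, Finset.noncommProd_insert_of_notMem _ _ _ _ hν]
    have h1 : Tri (baseWt n ∘ (1 : Equiv.Perm (Fin (n + 1)))) 1 _ (shiftY q th J ν) :=
      shiftY_tri hth J ν
    refine (h1.mul ih).congr (one_mul 1) fun μ => ?_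
    rw [Finset.prod_insert hν, mul_comm, Equiv.Perm.coe_one, Function.comp_id]

/-- A Cayley–Hamilton argument. The factors commute, so the one at `ν` may act first; it sends `x^ν`
to strictly lower monomials, which the remaining factors kill by induction. -/
theorem prodShiftY_mon_eq_zero (hq : q ≠ 0) (hth : th ≠ 0)
    (J : (Fin (n + 1) → ℤ) → Fin (n + 1)) (ν : Fin (n + 1) → ℤ) :
    ∀ S : Finset (Fin (n + 1) → ℤ), ν ∈ S → (∀ κ, Lower (baseWt n) κ ν → κ ∈ S) →
      prodShiftY hq hth J S (mon ν) = 0 := by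
  classical
  induction ν using lower_induction (baseWt n) with
  | h ν ih =>
    intro S hν hS
    have h1 := shiftY_mon_sub_mem (q := q) hth J ν ν
    rw [sub_self, zero_smul, sub_zero] at h1
    rw [prodShiftY, ← Finset.noncommProd_erase_mul _ hν, Module.End.mul_apply]
    change prodShiftY hq hth J (S.erase ν) _ = 0
    generalize shiftY q th J ν (mon ν) = f at h1 ⊢
    induction h1 using Submodule.span_induction with
    | mem x hx =>
      obtain ⟨κ, hκ, rfl⟩ := hx
      have hne : ∀ κ, Lower (baseWt n) κ ν → κ ∈ S.erase ν := fun κ h =>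
        Finset.mem_erase.mpr ⟨fun e => Lower.irrefl _ _ (e ▸ h), hS κ h⟩
      exact ih κ hκ _ (hne κ hκ) fun κ' h' => hne κ' (h'.trans hκ)
    | zero => exact map_zero _
    | add x y _ _ hx hy => rw [map_add, hx, hy, add_zero]
    | smul a x _ hx => rw [map_smul, hx, smul_zero]

/-- For each `ν` below `μ` choose a coordinate `J ν` where the eigenvalues differ. The product `P`
of the operators `shiftY` over these `ν` kills `Low`, commutes with all `Y_i`, and multiplies the
leading term of `x^μ` by `a ≠ 0`. As `Y_i - eig` maps `x^μ` into `Low`, `a⁻¹ P x^μ` is an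
eigenvector. -/
theorem exists_eigenvector (hq : q ≠ 0) (hth : th ≠ 0)
    (hgen : ∀ μ ν : Fin (n + 1) → ℤ, (∀ i, eig q th μ i = eig q th ν i) → μ = ν)
    (μ : Fin (n + 1) → ℤ) :
    ∃ f, (∀ i, Y q th i f = eig q th μ i • f) ∧ f - mon μ ∈ Low (baseWt n) μ := by
  have hJ : ∀ ν, ∃ j, ν ≠ μ → eig q th μ j - eig q th ν j ≠ 0 := by
    intro ν
    by_contra hcon
    push Not at hcon
    exact (hcon 0).1 (hgen ν μ fun i => (sub_eq_zero.mp (hcon i).2).symm)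
  choose J hJ using hJ
  let S := (finite_lower (baseWt n) μ).toFinset
  have hS : ∀ ν, ν ∈ S ↔ Lower (baseWt n) ν μ := fun ν => Set.Finite.mem_toFinset _
  set a := ∏ ν ∈ S, (eig q th μ (J ν) - eig q th ν (J ν)) with ha
  have ha0 : a ≠ 0 := Finset.prod_ne_zero_iff.mpr fun ν hν =>
    hJ ν fun e => Lower.irrefl _ _ (e ▸ (hS ν).mp hν)
  have hkill : ∀ f ∈ Low (baseWt n) μ, prodShiftY hq hth J S f = 0 := by
    intro f hf
    induction hf using Submodule.span_induction with
    | mem x hx =>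
      obtain ⟨κ, hκ, rfl⟩ := hx
      exact prodShiftY_mon_eq_zero hq hth J κ S ((hS κ).mpr hκ) fun κ' h' =>
        (hS κ').mpr (h'.trans hκ)
    | zero => exact map_zero _
    | add x y _ _ hx hy => rw [map_add, hx, hy, add_zero]
    | smul a x _ hx => rw [map_smul, hx, smul_zero]
  refine ⟨a⁻¹ • prodShiftY hq hth J S (mon μ), fun i => ?_, ?_⟩
  · have hc : Commute (Y q th i) (prodShiftY hq hth J S) :=
      Finset.noncommProd_commute _ _ _ _ fun ν _ => commute_Y_shiftY hq hth J ν i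
    have h1 := hkill _ (Y_mon_sub_mem (q := q) hth i μ)
    rw [map_sub, map_smul, sub_eq_zero, ← Module.End.mul_apply, ← hc.eq,
      Module.End.mul_apply] at h1
    rw [map_smul, h1, smul_comm]
  · have h1 : prodShiftY hq hth J S (mon μ) - a • mon μ ∈ Low (baseWt n) μ :=
      prodShiftY_tri hq hth J S μ
    have h2 := Submodule.smul_mem _ a⁻¹ h1
    rwa [smul_sub, inv_smul_smul₀ ha0] at h2

theorem linearIndependent_of_eigenvectors (hq : q ≠ 0) (hth : th ≠ 0)
    (hgen : ∀ μ ν : Fin (n + 1) → ℤ, (∀ i, eig q th μ i = eig q th ν i) → μ = ν)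
    {e : (Fin (n + 1) → ℤ) → Laurent (n + 1)}
    (he : ∀ μ i, Y q th i (e μ) = eig q th μ i • e μ) (h0 : ∀ μ, e μ ≠ 0) :
    LinearIndependent ℂ e := by
  have h1 := Module.End.independent_iInf_maxGenEigenspace_of_forall_mapsTo
    (Y (n := n) q th) fun i j φ =>
      Module.End.mapsTo_maxGenEigenspace_of_comm ((affineHeckeRelations hq hth).Y_comm j i) φ
  have h2 := h1.comp (f := eig q th) fun μ ν h => hgen μ ν (congrFun h)
  refine h2.linearIndependent _ (fun μ => ?_) h0
  refine (Submodule.mem_iInf _).mpr fun i => ?_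
  refine Module.End.mem_maxGenEigenspace _ _ _ |>.mpr ⟨1, ?_⟩
  simp [he]

theorem span_eq_top_of_triangular {c : Fin (n + 1) → ℤ}
    {e : (Fin (n + 1) → ℤ) → Laurent (n + 1)} (he : ∀ μ, e μ - mon μ ∈ Low c μ) :
    ⊤ ≤ Submodule.span ℂ (Set.range e) := by
  have h1 : ∀ μ, mon μ ∈ Submodule.span ℂ (Set.range e) := by
    intro μ
    induction μ using lower_induction c with
    | h μ ih =>
      have h2 : Low c μ ≤ Submodule.span ℂ (Set.range e) := by
        refine Submodule.span_le.mpr ?_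
        rintro _ ⟨ν, hν, rfl⟩
        exact ih ν hν
      have h3 := Submodule.sub_mem _ (Submodule.subset_span (Set.mem_range_self μ)) (h2 (he μ))
      rwa [sub_sub_cancel] at h3
  intro f _
  induction f using AddMonoidAlgebra.induction_on with
  | of m => exact h1 m
  | add x y hx hy => exact Submodule.add_mem _ (hx trivial) (hy trivial)
  | smul a x hx => exact Submodule.smul_mem _ a (hx trivial)

/-- A basis of joint eigenvectors. -/
noncomputable def eigBasis (hq : q ≠ 0) (hth : th ≠ 0)
    (hgen : ∀ μ ν : Fin (n + 1) → ℤ, (∀ i, eig q th μ i = eig q th ν i) → μ = ν) :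
    Module.Basis (Fin (n + 1) → ℤ) ℂ (Laurent (n + 1)) :=
  Module.Basis.mk
    (linearIndependent_of_eigenvectors hq hth hgen
      (fun μ => (exists_eigenvector hq hth hgen μ).choose_spec.1) fun μ h0 => by
        have h := coeff_eq_one (exists_eigenvector hq hth hgen μ).choose_spec.2
        rw [h0] at h
        simp at h)
    (span_eq_top_of_triangular fun μ => (exists_eigenvector hq hth hgen μ).choose_spec.2)

/-! ### Expansion in the eigenbasis and uniqueness. -/

variable (hq : q ≠ 0) (hth : th ≠ 0)
  (hgen : ∀ μ ν : Fin (n + 1) → ℤ, (∀ i, eig q th μ i = eig q th ν i) → μ = ν)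

include hq hth hgen

theorem Y_eigBasis (i : Fin (n + 1)) (μ : Fin (n + 1) → ℤ) :
    Y q th i (eigBasis hq hth hgen μ) = eig q th μ i • eigBasis hq hth hgen μ := by
  rw [eigBasis, Module.Basis.mk_apply]
  exact (exists_eigenvector hq hth hgen μ).choose_spec.1 i

theorem eigBasis_sub_mon_mem (μ : Fin (n + 1) → ℤ) :
    eigBasis hq hth hgen μ - mon μ ∈ Low (baseWt n) μ := by
  rw [eigBasis, Module.Basis.mk_apply]
  exact (exists_eigenvector hq hth hgen μ).choose_spec.2

theorem repr_Y (i : Fin (n + 1)) (f : Laurent (n + 1)) (ν : Fin (n + 1) → ℤ) :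
    (eigBasis hq hth hgen).repr (Y q th i f) ν =
      eig q th ν i * (eigBasis hq hth hgen).repr f ν := by
  have : (eigBasis hq hth hgen).coord ν ∘ₗ Y q th i =
      eig q th ν i • (eigBasis hq hth hgen).coord ν := by
    refine (eigBasis hq hth hgen).ext fun μ => ?_
    simp only [LinearMap.comp_apply, Y_eigBasis, map_smul, LinearMap.smul_apply,
      Module.Basis.coord_apply, Module.Basis.repr_self, smul_eq_mul]
    by_cases h : μ = ν
    · rw [h]
    · simp [h]
  exact LinearMap.congr_fun this f

theorem eig_eq_of_repr_ne_zero {y : Fin (n + 1) → ℂ} {f : Laurent (n + 1)}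
    (hf : ∀ i, Y q th i f = y i • f) {ν : Fin (n + 1) → ℤ}
    (hν : (eigBasis hq hth hgen).repr f ν ≠ 0) (i : Fin (n + 1)) : eig q th ν i = y i := by
  have h := repr_Y hq hth hgen i f ν
  rw [hf, map_smul, Finsupp.smul_apply, smul_eq_mul] at h
  exact (mul_right_cancel₀ hν h).symm

theorem eq_zero_of_eig_ne {y : Fin (n + 1) → ℂ} {f : Laurent (n + 1)}
    (hf : ∀ i, Y q th i f = y i • f) (hy : ∀ ν, ¬ ∀ i, eig q th ν i = y i) : f = 0 := by
  refine (eigBasis hq hth hgen).repr.map_eq_zero_iff.mp (Finsupp.ext fun ν => ?_)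
  by_contra hν
  exact hy ν (eig_eq_of_repr_ne_zero hq hth hgen hf hν)

/-- Each `Y_i` acts diagonally on coordinates, so only coordinates with the tuple of `μ` survive,
and by genericity that is `μ` alone. No triangularity of `f` is assumed. -/
theorem eq_coeff_smul_eigBasis {μ : Fin (n + 1) → ℤ} {f : Laurent (n + 1)}
    (hf : ∀ i, Y q th i f = eig q th μ i • f) : f = f.coeff μ • eigBasis hq hth hgen μ := by
  obtain ⟨a, ha⟩ : ∃ a : ℂ, f = a • eigBasis hq hth hgen μ := by
    refine ⟨(eigBasis hq hth hgen).repr f μ, (eigBasis hq hth hgen).repr.injective ?_⟩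
    ext ν
    rw [map_smul, Module.Basis.repr_self]
    by_cases h : μ = ν
    · simp [h]
    · have : (eigBasis hq hth hgen).repr f ν = 0 := by
        by_contra hν
        exact h (hgen _ _ (eig_eq_of_repr_ne_zero hq hth hgen hf hν)).symm
      simp [h, this]
  have h1 : f.coeff μ = a := by
    rw [ha, AddMonoidAlgebra.coeff_smul, Finsupp.smul_apply,
      coeff_eq_one (eigBasis_sub_mon_mem hq hth hgen μ), smul_eq_mul, mul_one]
  rw [h1, ← ha]

theorem isNonsymMacdonald_eigBasis (μ : Fin (n + 1) → ℤ) :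
    IsNonsymMacdonald q th μ (eigBasis hq hth hgen μ) :=
  ⟨fun i => Y_eigBasis hq hth hgen i μ, coeff_eq_one (eigBasis_sub_mon_mem hq hth hgen μ)⟩

theorem eq_eigBasis {μ : Fin (n + 1) → ℤ} {f : Laurent (n + 1)}
    (hf : IsNonsymMacdonald q th μ f) : f = eigBasis hq hth hgen μ := by
  have h := eq_coeff_smul_eigBasis hq hth hgen hf.1
  rwa [hf.2, one_smul] at h

theorem E_eq_eigBasis (μ : Fin (n + 1) → ℤ) : E q th μ = eigBasis hq hth hgen μ :=
  eq_eigBasis hq hth hgen (Classical.epsilon_spec ⟨_, isNonsymMacdonald_eigBasis hq hth hgen μ⟩)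

end Eigenbasis

/-! ### The action of the affine Hecke algebra on the `E_μ` -/

theorem inverse_apply_of_eq_smul {N : ℕ} {A : Module.End ℂ (Laurent N)} (hA : IsUnit A) {c : ℂ}
    (hc : c ≠ 0) {f : Laurent N} (h : A f = c • f) : Ring.inverse A f = c⁻¹ • f := by
  have h1 := LinearMap.congr_fun (Ring.inverse_mul_cancel _ hA) f
  rw [Module.End.mul_apply, h, map_smul, Module.End.one_apply] at h1
  rw [← h1, inv_smul_smul₀ hc, h1]

theorem Tri.coeff_apply {N : ℕ} {c : Fin N → ℤ} {π : Equiv.Perm (Fin N)}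
    {d : (Fin N → ℤ) → ℂ} {A : Module.End ℂ (Laurent N)} (h : Tri c π d A) {μ : Fin N → ℤ}
    {f : Laurent N} (hf : f - mon μ ∈ Low c μ) : (A f).coeff (μ ∘ π) = d μ := by
  have h1 := Submodule.add_mem _ (h.apply_mem_Low hf) (h μ)
  rw [map_sub, sub_add_sub_cancel] at h1
  have h2 := coeff_eq_zero_of_mem_Low h1 (Lower.irrefl _ _)
  rw [AddMonoidAlgebra.coeff_sub, AddMonoidAlgebra.coeff_smul, Finsupp.sub_apply,
    Finsupp.smul_apply, coeff_mon, if_pos rfl, smul_eq_mul, mul_one, sub_eq_zero] at h2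
  exact h2

section Action

variable {n : ℕ} {q th : ℂ}

/-- The Bernstein relation `Y_i T_i = T_i Y_{i+1} + (th - th⁻¹) Y_i`, evaluated on a joint
eigenvector. -/
theorem Y_castSucc_T_apply (hq : q ≠ 0) (hth : th ≠ 0) {i : Fin n} {f : Laurent (n + 1)} {y y' : ℂ}
    (h : Y q th i.castSucc f = y • f) (h' : Y q th i.succ f = y' • f) :
    Y q th i.castSucc (T th i f) = y' • T th i f + ((th - th⁻¹) * y) • f := by
  have h1 := LinearMap.congr_fun ((affineHeckeRelations hq hth).T_Y_T i)
  have h2 := LinearMap.congr_fun (T_quadratic hth i) f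
  simp only [Module.End.mul_apply, LinearMap.add_apply, LinearMap.smul_apply,
    Module.End.one_apply] at h1 h2
  rw [← h1, h2, map_add, map_add, map_smul, map_smul, h1, h, h', map_smul, smul_smul]
  exact add_comm _ _

theorem Y_succ_T_apply (hq : q ≠ 0) (hth : th ≠ 0) {i : Fin n} {f : Laurent (n + 1)} {y : ℂ}
    (h : Y q th i.castSucc f = y • f) :
    Y q th i.succ (T th i f) = y • T th i f - ((th - th⁻¹) * y) • f := by
  have h1 := LinearMap.congr_fun ((affineHeckeRelations hq hth).T_Y_T i) f
  have h3 := LinearMap.congr_fun (Ring.inverse_mul_cancel _ (isUnit_T hth i))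
    (Y q th i.succ (T th i f))
  simp only [Module.End.mul_apply, Module.End.one_apply] at h1 h3
  rw [← h3, h1, h, map_smul, inverse_T hth, LinearMap.sub_apply, LinearMap.smul_apply,
    Module.End.one_apply]
  module

variable (hq : q ≠ 0) (hth : th ≠ 0) (ht : th ^ 2 ≠ 1)
  (hgen : ∀ μ ν : Fin (n + 1) → ℤ, (∀ i, eig q th μ i = eig q th ν i) → μ = ν)

include hq hth hgen

theorem Y_E (i : Fin (n + 1)) (μ : Fin (n + 1) → ℤ) :
    Y q th i (E q th μ) = eig q th μ i • E q th μ := by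
  rw [E_eq_eigBasis hq hth hgen]; exact Y_eigBasis hq hth hgen i μ

theorem inverse_Y_E (i : Fin (n + 1)) (μ : Fin (n + 1) → ℤ) :
    Ring.inverse (Y q th i) (E q th μ) = (eig q th μ i)⁻¹ • E q th μ :=
  inverse_apply_of_eq_smul ((affineHeckeRelations hq hth).isUnit_Y i) (eig_ne_zero hq hth μ i)
    (Y_E hq hth hgen i μ)

theorem E_sub_mon_mem (μ : Fin (n + 1) → ℤ) : E q th μ - mon μ ∈ Low (baseWt n) μ := by
  rw [E_eq_eigBasis hq hth hgen]; exact eigBasis_sub_mon_mem hq hth hgen μ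

theorem YY_E (i : Fin n) (μ : Fin (n + 1) → ℤ) :
    YY q th i (E q th μ) = a q th i μ • E q th μ := by
  rw [YY, Module.End.mul_apply, Y_E hq hth hgen, map_smul, inverse_Y_E hq hth hgen, smul_smul,
    ← div_eq_mul_inv, eig_div_eig hq hth, a]

omit hgen in
theorem a_eq_div (i : Fin n) (μ : Fin (n + 1) → ℤ) :
    a q th i μ = eig q th μ i.succ / eig q th μ i.castSucc :=
  (eig_div_eig hq hth μ _ _).symm

omit hgen in
theorem a'_eq_inv (i : Fin n) (μ : Fin (n + 1) → ℤ) : a' q th i μ = (a q th i μ)⁻¹ := by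
  rw [a_eq_div hq hth, inv_div, eig_div_eig hq hth, a']

omit hgen in
-- `a'` is written with `v_μ`; this identifies it with the eigenvalue belonging to `s_i μ`.
theorem a_sAct {i : Fin n} {μ : Fin (n + 1) → ℤ} (h : μ i.castSucc ≠ μ i.succ) :
    a q th i (sAct i μ) = a' q th i μ := by
  rw [a_eq_div hq hth, eig_sAct h, eig_sAct h, Equiv.swap_apply_left, Equiv.swap_apply_right,
    eig_div_eig hq hth, a']

include ht

theorem a_ne_one (i : Fin n) (μ : Fin (n + 1) → ℤ) : a q th i μ ≠ 1 := by
  rw [a_eq_div hq hth, Ne, div_eq_one_iff_eq (eig_ne_zero hq hth _ _)]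
  exact eig_succ_ne_eig_castSucc hq hth ht hgen i μ

/-- Diagonal on the eigenbasis with entries `1 - a ≠ 0`. Invertibility on the whole space is needed
because `Ring.inverse` is `0` on non-units. -/
theorem isUnit_one_sub_YY (i : Fin n) : IsUnit (1 - YY q th i) := by
  let b := eigBasis hq hth hgen
  have hb : ∀ μ, YY q th i (b μ) = a q th i μ • b μ := fun μ => by
    have h := YY_E hq hth hgen i μ
    rwa [E_eq_eigBasis hq hth hgen] at h
  let B : Module.End ℂ (Laurent (n + 1)) := b.constr ℂ fun μ => (1 - a q th i μ)⁻¹ • b μ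
  have hB : ∀ μ, B (b μ) = (1 - a q th i μ)⁻¹ • b μ := fun μ => b.constr_basis ℂ _ μ
  have h0 : ∀ μ, 1 - a q th i μ ≠ 0 := fun μ =>
    sub_ne_zero.mpr (a_ne_one hq hth ht hgen i μ).symm
  have h1 : ∀ μ, (1 - YY q th i) (b μ) = (1 - a q th i μ) • b μ := fun μ => by
    rw [LinearMap.sub_apply, Module.End.one_apply, hb, sub_smul, one_smul]
  refine ⟨⟨1 - YY q th i, B, b.ext fun μ => ?_, b.ext fun μ => ?_⟩, rfl⟩
  · rw [Module.End.mul_apply, hB, map_smul, h1, inv_smul_smul₀ (h0 μ), Module.End.one_apply]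
  · rw [Module.End.mul_apply, h1, map_smul, hB, smul_inv_smul₀ (h0 μ), Module.End.one_apply]

theorem smul_tau_E (i : Fin n) (μ : Fin (n + 1) → ℤ) :
    (th • tau q th i) (E q th μ) =
      (th • T th i) (E q th μ) + ((1 - th ^ 2) / (1 - a q th i μ)) • E q th μ := by
  have h1 : (1 - YY q th i) (E q th μ) = (1 - a q th i μ) • E q th μ := by
    rw [LinearMap.sub_apply, Module.End.one_apply, YY_E hq hth hgen, sub_smul, one_smul]
  have h2 := inverse_apply_of_eq_smul (isUnit_one_sub_YY hq hth ht hgen i)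
    (sub_ne_zero.mpr (a_ne_one hq hth ht hgen i μ).symm) h1
  rw [tau, LinearMap.smul_apply, LinearMap.smul_apply, LinearMap.add_apply, LinearMap.smul_apply,
    h2, smul_add, smul_smul, smul_smul]
  congr 2
  field_simp

/-- On the span of `E_μ` and `T_i E_μ` the operators `Y_i`, `Y_{i+1}` are triangular with the two
eigenvalues exchanged modulo `E_μ`. The constant in `τ_i` is the correction that makes an
eigenvector. -/
theorem Y_tau_E (i : Fin n) (μ : Fin (n + 1) → ℤ) (j : Fin (n + 1)) :
    Y q th j ((th • tau q th i) (E q th μ)) =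
      eig q th μ (Equiv.swap i.castSucc i.succ j) • (th • tau q th i) (E q th μ) := by
  have hy := eig_ne_zero hq hth μ i.castSucc
  have hne := sub_ne_zero.mpr (eig_succ_ne_eig_castSucc hq hth ht hgen i μ).symm
  have hc : (1 - th ^ 2) / (1 - a q th i μ) = -(th * (th - th⁻¹) * eig q th μ i.castSucc) /
      (eig q th μ i.castSucc - eig q th μ i.succ) := by
    rw [a_eq_div hq hth]
    have : 1 - eig q th μ i.succ / eig q th μ i.castSucc =
      (eig q th μ i.castSucc - eig q th μ i.succ) / eig q th μ i.castSucc := by field_simp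
    rw [this]
    field_simp
    ring
  rw [smul_tau_E hq hth ht hgen, hc, LinearMap.smul_apply, map_add, map_smul, map_smul,
    Y_E hq hth hgen]
  by_cases h1 : j = i.castSucc
  · subst h1
    rw [Equiv.swap_apply_left,
      Y_castSucc_T_apply hq hth (Y_E hq hth hgen _ μ) (Y_E hq hth hgen _ μ)]
    match_scalars
    · ring
    · field_simp
      ring
  · by_cases h2 : j = i.succ
    · subst h2
      rw [Equiv.swap_apply_right, Y_succ_T_apply hq hth (Y_E hq hth hgen _ μ)]
      match_scalars
      · ring
      · field_simp
        ring
    · have h3 := LinearMap.congr_fun ((affineHeckeRelations hq hth).T_Y i j h1 h2) (E q th μ)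
      rw [Module.End.mul_apply, Module.End.mul_apply, Y_E hq hth hgen, map_smul] at h3
      rw [Equiv.swap_apply_of_ne_of_ne h1 h2, ← h3]
      module

/-- The result is a multiple of `E_{s_i μ}`, and the multiple is its coefficient at `x^{s_i μ}`:
`T_i` contributes `th⁻¹`, and `E_μ` contributes `0`, since `s_i μ` has the same norm as `μ` and
larger weight. -/
theorem smul_tau_E_of_gt {i : Fin n} {μ : Fin (n + 1) → ℤ} (h : μ i.succ < μ i.castSucc) :
    (th • tau q th i) (E q th μ) = E q th (sAct i μ) := by
  have h1 := eq_coeff_smul_eigBasis hq hth hgen (μ := sAct i μ)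
    (f := (th • tau q th i) (E q th μ)) fun j => by
      rw [eig_sAct h.ne']; exact Y_tau_E hq hth ht hgen i μ j
  have hlt : baseWt n i.castSucc < baseWt n i.succ := by simp [baseWt]
  have h2 : (T th i (E q th μ)).coeff (sAct i μ) = th⁻¹ := by
    have h3 := (tri_T hth hlt).coeff_apply (E_sub_mon_mem hq hth hgen μ)
    rwa [if_pos h] at h3
  have h4 : (E q th μ).coeff (sAct i μ) = 0 := by
    have hw := wt_sub_wt_sAct (baseWt n) i μ
    have hneg : (baseWt n i.succ - baseWt n i.castSucc) * (μ i.succ - μ i.castSucc) < 0 :=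
      mul_neg_of_pos_of_neg (by omega) (by omega)
    have h5 := coeff_eq_zero_of_mem_Low (E_sub_mon_mem hq hth hgen μ) (ν := sAct i μ) (by
      rintro (h5 | h5)
      · rw [sAct, sqNorm_comp] at h5; exact lt_irrefl _ h5
      · omega)
    have hne : μ ≠ sAct i μ := fun e => by
      have := congrFun e i.succ
      rw [sAct, Function.comp, Equiv.swap_apply_right] at this
      omega
    rwa [AddMonoidAlgebra.coeff_sub, Finsupp.sub_apply, coeff_mon, if_neg hne, sub_zero] at h5
  have h6 : ((th • tau q th i) (E q th μ)).coeff (sAct i μ) = 1 := by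
    rw [smul_tau_E hq hth ht hgen, LinearMap.smul_apply, AddMonoidAlgebra.coeff_add,
      AddMonoidAlgebra.coeff_smul, AddMonoidAlgebra.coeff_smul, Finsupp.add_apply,
      Finsupp.smul_apply, Finsupp.smul_apply, h2, h4, smul_zero, add_zero, smul_eq_mul,
      mul_inv_cancel₀ hth]
  rw [h6, one_smul] at h1
  rw [h1, E_eq_eigBasis hq hth hgen]

theorem smul_T_E_of_gt {i : Fin n} {μ : Fin (n + 1) → ℤ} (h : μ i.succ < μ i.castSucc) :
    (th • T th i) (E q th μ) =
      -((1 - th ^ 2) / (1 - a q th i μ)) • E q th μ + E q th (sAct i μ) := by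
  rw [← smul_tau_E_of_gt hq hth ht hgen h, smul_tau_E hq hth ht hgen]
  module

/-- Apply `th • T_i` again to its value on `E_μ` and solve the quadratic relation for the unknown
term; `D` appears on substituting `a' = a⁻¹`. -/
theorem smul_T_E_sAct_of_gt {i : Fin n} {μ : Fin (n + 1) → ℤ} (h : μ i.succ < μ i.castSucc) :
    (th • T th i) (E q th (sAct i μ)) =
      D q th i μ • E q th μ - ((1 - th ^ 2) / (1 - a' q th i μ)) • E q th (sAct i μ) := by
  have hT := smul_T_E_of_gt hq hth ht hgen h
  have hquad : (th • T th i) ((th • T th i) (E q th μ)) =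
      (th ^ 2 - 1) • (th • T th i) (E q th μ) + th ^ 2 • E q th μ := by
    have h2 := LinearMap.congr_fun (T_quadratic hth i) (E q th μ)
    simp only [Module.End.mul_apply, LinearMap.add_apply, LinearMap.smul_apply,
      Module.End.one_apply, map_smul] at h2 ⊢
    rw [h2]
    match_scalars <;> field_simp
  rw [hT, map_add, map_smul, hT] at hquad
  have ha0 : a q th i μ ≠ 0 := by
    rw [a_eq_div hq hth]; exact div_ne_zero (eig_ne_zero hq hth _ _) (eig_ne_zero hq hth _ _)
  have ha1 : 1 - a q th i μ ≠ 0 := sub_ne_zero.mpr (a_ne_one hq hth ht hgen i μ).symm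
  have ha2 : a q th i μ - 1 ≠ 0 := sub_ne_zero.mpr (a_ne_one hq hth ht hgen i μ)
  rw [← eq_sub_iff_add_eq'] at hquad
  rw [hquad, D, a'_eq_inv hq hth]
  have e : 1 - (a q th i μ)⁻¹ = -((1 - a q th i μ) / a q th i μ) := by field_simp; ring
  rw [e]
  match_scalars
  · field_simp
    ring
  · field_simp
    ring

theorem smul_tau_E_sAct_of_gt {i : Fin n} {μ : Fin (n + 1) → ℤ} (h : μ i.succ < μ i.castSucc) :
    (th • tau q th i) (E q th (sAct i μ)) = D q th i μ • E q th μ := by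
  rw [smul_tau_E hq hth ht hgen, smul_T_E_sAct_of_gt hq hth ht hgen h, a_sAct hq hth h.ne',
    sub_add_cancel]

theorem smul_tau_E_of_eq {i : Fin n} {μ : Fin (n + 1) → ℤ} (h : μ i.castSucc = μ i.succ) :
    (th • tau q th i) (E q th μ) = 0 :=
  eq_zero_of_eig_ne hq hth hgen (Y_tau_E hq hth ht hgen i μ) (eig_swap_ne hq hth ht hgen h)

omit hq hth ht hgen in
theorem a_of_eq {i : Fin n} {μ : Fin (n + 1) → ℤ} (h : μ i.castSucc = μ i.succ) :
    a q th i μ = (th ^ 2)⁻¹ := by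
  rw [a, ratio, h, vPerm_succ_of_eq h]
  simp

theorem smul_T_E_of_eq {i : Fin n} {μ : Fin (n + 1) → ℤ} (h : μ i.castSucc = μ i.succ) :
    (th • T th i) (E q th μ) = th ^ 2 • E q th μ := by
  have h1 := smul_tau_E_of_eq hq hth ht hgen h
  rw [smul_tau_E hq hth ht hgen, a_of_eq h, add_eq_zero_iff_eq_neg] at h1
  have h2 : th ^ 2 - 1 ≠ 0 := sub_ne_zero.mpr ht
  have e : 1 - (th ^ 2)⁻¹ = (th ^ 2 - 1) / th ^ 2 := by field_simp
  rw [h1, e, ← neg_smul]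
  congr 1
  field_simp
  ring

/-! ### The decomposition of `ℂ[X]` -/

theorem smul_T_E_mem_CX (l : Fin (n + 1) → ℤ) (i : Fin n) (μ : Fin (n + 1) → ℤ)
    (hμ : ∃ σ : Equiv.Perm (Fin (n + 1)), μ = l ∘ σ) : (th • T th i) (E q th μ) ∈ CX q th l := by
  have h1 : E q th μ ∈ CX q th l := Submodule.subset_span ⟨μ, hμ, rfl⟩
  have h2 : E q th (sAct i μ) ∈ CX q th l := by
    obtain ⟨σ, rfl⟩ := hμ
    exact Submodule.subset_span ⟨_, ⟨σ * Equiv.swap i.castSucc i.succ, rfl⟩, rfl⟩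
  rcases lt_trichotomy (μ i.castSucc) (μ i.succ) with h | h | h
  · have h3 := smul_T_E_sAct_of_gt hq hth ht hgen (μ := sAct i μ) (i := i) (by simpa [sAct] using h)
    rw [sAct_sAct] at h3
    rw [h3]
    exact Submodule.sub_mem _ (Submodule.smul_mem _ _ h2) (Submodule.smul_mem _ _ h1)
  · rw [smul_T_E_of_eq hq hth ht hgen h]
    exact Submodule.smul_mem _ _ h1
  · rw [smul_T_E_of_gt hq hth ht hgen h]
    exact Submodule.add_mem _ (Submodule.smul_mem _ _ h1) h2

theorem H_apply_mem_CX (l : Fin (n + 1) → ℤ) {h : Module.End ℂ (Laurent (n + 1))}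
    (hh : h ∈ H n q th) : ∀ f ∈ CX q th l, h f ∈ CX q th l := by
  have key : ∀ A : Module.End ℂ (Laurent (n + 1)), (∀ μ : Fin (n + 1) → ℤ,
      (∃ σ : Equiv.Perm (Fin (n + 1)), μ = l ∘ σ) → A (E q th μ) ∈ CX q th l) →
      ∀ f ∈ CX q th l, A f ∈ CX q th l := by
    intro A hA f hf
    refine (Submodule.span_le (p := (CX q th l).comap A)).mpr ?_ hf
    rintro _ ⟨μ, hμ, rfl⟩
    exact hA μ hμ
  induction hh using Algebra.adjoin_induction with
  | mem A hA =>
    refine key A fun μ hμ => ?_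
    have h1 : E q th μ ∈ CX q th l := Submodule.subset_span ⟨μ, hμ, rfl⟩
    rcases hA with (⟨i, rfl⟩ | ⟨j, rfl⟩) | ⟨j, rfl⟩
    · exact (Submodule.smul_mem_iff _ hth).mp (smul_T_E_mem_CX hq hth ht hgen l i μ hμ)
    · rw [Y_E hq hth hgen]
      exact Submodule.smul_mem _ _ h1
    · change Ring.inverse (Y q th j) _ ∈ _
      rw [inverse_Y_E hq hth hgen]
      exact Submodule.smul_mem _ _ h1
  | algebraMap r => exact fun f hf => Submodule.smul_mem _ r hf
  | add A B _ _ hA hB => exact fun f hf => Submodule.add_mem _ (hA f hf) (hB f hf)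
  | mul A B _ _ hA hB => exact fun f hf => hA _ (hB f hf)

omit ht

theorem linearIndependent_E : LinearIndependent ℂ (E (n := n) q th) := by
  have : E (n := n) q th = eigBasis hq hth hgen := funext (E_eq_eigBasis hq hth hgen)
  rw [this]
  exact (eigBasis hq hth hgen).linearIndependent

omit hq hth hgen in
theorem antitone_eq_of_perm {N : ℕ} {l l' : Fin N → ℤ} (hl : Antitone l) (hl' : Antitone l')
    {σ σ' : Equiv.Perm (Fin N)} (h : l ∘ σ = l' ∘ σ') : l = l' := by
  have e : l = l' ∘ (σ⁻¹.trans σ') := by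
    funext j
    have := congrFun h (σ⁻¹ j)
    simpa using this
  have h1 := Tuple.unique_monotone (f := OrderDual.toDual ∘ l') (σ := σ⁻¹.trans σ') (τ := 1)
    (by rw [Function.comp_assoc, ← e]; exact hl.dual_right) hl'.dual_right
  funext j
  have h2 := congrFun h1 j
  rw [e]
  exact h2

omit hq hth hgen in
theorem exists_antitone_perm {N : ℕ} (μ : Fin N → ℤ) :
    ∃ l : Fin N → ℤ, Antitone l ∧ ∃ σ : Equiv.Perm (Fin N), μ = l ∘ σ := by
  refine ⟨μ ∘ Tuple.sort (OrderDual.toDual ∘ μ), ?_, (Tuple.sort (OrderDual.toDual ∘ μ))⁻¹, ?_⟩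
  · intro j k hjk
    exact Tuple.monotone_sort (OrderDual.toDual ∘ μ) hjk
  · funext j; simp

/-- Distinct decreasing `λ` have disjoint orbits, and disjoint parts of an independent family have
independent spans. Every `μ` can be sorted decreasingly, so the spans exhaust the space. -/
theorem isInternal_CX : DirectSum.IsInternal
    (fun l : {l : Fin (n + 1) → ℤ // Antitone l} => CX q th l.1) := by
  rw [DirectSum.isInternal_submodule_iff_iSupIndep_and_iSup_eq_top]
  constructor
  · intro l
    refine Disjoint.mono_right ?_ ((linearIndependent_E hq hth hgen).disjoint_span_image
      (s := {μ | ∃ σ : Equiv.Perm (Fin (n + 1)), μ = l.1 ∘ σ}) disjoint_compl_right)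
    refine iSup₂_le fun l' hl' => Submodule.span_mono (Set.image_mono ?_)
    rintro _ ⟨σ', rfl⟩ ⟨σ, hσ⟩
    exact hl' (Subtype.ext (antitone_eq_of_perm l'.2 l.2 hσ))
  · rw [eq_top_iff]
    refine (span_eq_top_of_triangular (E_sub_mon_mem hq hth hgen)).trans (Submodule.span_le.mpr ?_)
    rintro _ ⟨μ, rfl⟩
    obtain ⟨l, hl, hσ⟩ := exists_antitone_perm μ
    exact le_iSup (fun l : {l : Fin (n + 1) → ℤ // Antitone l} => CX q th l.1) ⟨l, hl⟩
      (Submodule.subset_span ⟨μ, hσ, rfl⟩)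

end Action

end Macdonald

open Macdonald in
theorem mainTheorem3 (n : ℕ) (q th : ℂ) (hq : q ≠ 0) (hth : th ≠ 0) (ht : th ^ 2 ≠ 1)
    (hgen : ∀ μ ν : Fin (n + 1) → ℤ,
      (∀ i, Macdonald.eig q th μ i = Macdonald.eig q th ν i) → μ = ν) :
    -- all the objects are well defined
    (∀ i : Fin n, IsUnit (Macdonald.T th i)) ∧
    (∀ i : Fin n, IsUnit (1 - Macdonald.YY q th i)) ∧
    (∀ μ : Fin (n + 1) → ℤ, ∃! f, Macdonald.IsNonsymMacdonald q th μ f) ∧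
    -- `H` is an affine Hecke algebra
    Macdonald.AffineHeckeRelations th (Macdonald.T (n := n) th) (Macdonald.Y q th) ∧
    -- the `E_μ` are linearly independent, and `ℂ[X]` is the direct sum of the
    -- `H`-submodules `ℂ[X]^λ` over weakly decreasing `λ`
    LinearIndependent ℂ (Macdonald.E (n := n) q th) ∧
    (∀ l : Fin (n + 1) → ℤ, Antitone l → ∀ h ∈ Macdonald.H n q th,
      ∀ f ∈ Macdonald.CX q th l, h f ∈ Macdonald.CX q th l) ∧
    DirectSum.IsInternal
      (fun l : {l : Fin (n + 1) → ℤ // Antitone l} => Macdonald.CX q th l.1) ∧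
    -- the action when `μ_i > μ_{i+1}`
    (∀ (i : Fin n) (μ : Fin (n + 1) → ℤ), μ i.succ < μ i.castSucc →
      Macdonald.a q th i μ ≠ 1 ∧
      Macdonald.a' q th i μ ≠ 1 ∧
      Macdonald.YY q th i (Macdonald.E q th μ) =
        Macdonald.a q th i μ • Macdonald.E q th μ ∧
      (th • Macdonald.tau q th i) (Macdonald.E q th μ) =
        Macdonald.E q th (Macdonald.sAct i μ) ∧
      (th • Macdonald.T th i) (Macdonald.E q th μ) =
        -((1 - th ^ 2) / (1 - Macdonald.a q th i μ)) • Macdonald.E q th μ +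
          Macdonald.E q th (Macdonald.sAct i μ) ∧
      Macdonald.YY q th i (Macdonald.E q th (Macdonald.sAct i μ)) =
        Macdonald.a' q th i μ • Macdonald.E q th (Macdonald.sAct i μ) ∧
      (th • Macdonald.tau q th i) (Macdonald.E q th (Macdonald.sAct i μ)) =
        Macdonald.D q th i μ • Macdonald.E q th μ ∧
      (th • Macdonald.T th i) (Macdonald.E q th (Macdonald.sAct i μ)) =
        Macdonald.D q th i μ • Macdonald.E q th μ -
          ((1 - th ^ 2) / (1 - Macdonald.a' q th i μ)) •
            Macdonald.E q th (Macdonald.sAct i μ)) ∧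
    -- the action when `μ_i = μ_{i+1}`
    (∀ (i : Fin n) (μ : Fin (n + 1) → ℤ), μ i.castSucc = μ i.succ →
      ((Macdonald.vPerm μ i.succ : ℕ) = (Macdonald.vPerm μ i.castSucc : ℕ) + 1) ∧
      Macdonald.a q th i μ = (th ^ 2)⁻¹ ∧
      Macdonald.YY q th i (Macdonald.E q th μ) = (th ^ 2)⁻¹ • Macdonald.E q th μ ∧
      (th • Macdonald.tau q th i) (Macdonald.E q th μ) = 0 ∧
      (th • Macdonald.T th i) (Macdonald.E q th μ) = th ^ 2 • Macdonald.E q th μ) :=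
  ⟨isUnit_T hth, isUnit_one_sub_YY hq hth ht hgen,
    fun μ => ⟨_, isNonsymMacdonald_eigBasis hq hth hgen μ, fun _ h => eq_eigBasis hq hth hgen h⟩,
    affineHeckeRelations hq hth, linearIndependent_E hq hth hgen,
    fun l _ _ hh => H_apply_mem_CX hq hth ht hgen l hh, isInternal_CX hq hth hgen,
    fun i μ h => ⟨a_ne_one hq hth ht hgen i μ,
      a_sAct hq hth h.ne' ▸ a_ne_one hq hth ht hgen i (sAct i μ),
      YY_E hq hth hgen i μ, smul_tau_E_of_gt hq hth ht hgen h, smul_T_E_of_gt hq hth ht hgen h,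
      a_sAct hq hth h.ne' ▸ YY_E hq hth hgen i (sAct i μ),
      smul_tau_E_sAct_of_gt hq hth ht hgen h, smul_T_E_sAct_of_gt hq hth ht hgen h⟩,
    fun i μ h => ⟨vPerm_succ_of_eq h, a_of_eq h, a_of_eq (q := q) (th := th) h ▸ YY_E hq hth hgen i μ,
      smul_tau_E_of_eq hq hth ht hgen h, smul_T_E_of_eq hq hth ht hgen h⟩⟩
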